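/- A \emph{network} is a finite connected undirected graph whose edges have integer latencies $\ge 1$; $\Delta$ is its maximum degree, $D$ its weighted diameter (latencies as lengths), and $\mathrm{Vol}(U)=\sum_{v\in U}\deg v$. Latency class $1$ consists of the latencies $1,2$, and class $i\ge 2$ of the latencies in $(2^{i-1},2^i]$. For a cut $(U,V\setminus U)$ with both sides non-empty let $k_i(U)$ be the set of cut edges in class $i$, and put $$\phi_{avg}(U)=\frac{1}{\min\{\mathrm{Vol}(U),\mathrm{Vol}(V\setminus U)\}}\sum_{i\ge 1}\frac{|k_i(U)|}{2^i},\qquad \phi_{avg}=\min_U\phi_{avg}(U).$$ \emph{Gossip model.} Nodes know their identity and neighbours, but not the latencies. Time proceeds in synchronous rounds. In each round every node may choose, depending on its local state and on random bits, one neighbour with which it starts a bidirectional exchange; exchanges are non-blocking. An exchange over an edge of latency $\lambda$ started in round $r$ delivers to each endpoint, after $\lambda$ rounds, the message (of arbitrary content) that the other endpoint composed in round $r$; it passes on the rumor if that endpoint knew it at the start of the exchange. Initially exactly one designated source node knows the rumor; broadcast is solved in $T$ rounds if all nodes know the rumor after $T$ rounds. \textbf{Statement.} For all constants $a,b,C>0$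 there are constants $c_1,c_2>0$ and, for each $p>0$, a constant $\kappa_p>0$ such that the following holds for every integer $n\ge 1$, every real $\alpha\in[a/n,\,b]$ and every integer $\ell\in[1,\,C n^2\alpha^2]$. There is a finite non-empty class $\mathcal N$ of networks on $2n$ nodes such that every network in $\mathcal N$ satisfies $$c_1\frac{\alpha}{\ell}\le\phi_{avg}\le c_2\frac{\alpha}{\ell},\qquad c_1\alpha n\le\Delta\le c_2\alpha n,\qquad \frac{c_1}{\ell\,\phi_{avg}}\le D\le\frac{c_2}{\ell\,\phi_{avg}},$$ and such that for every randomized gossip algorithm, every source node, every $p>0$ and every integer $T\ge 0$: if, on a network drawn uniformly at random from $\mathcal N$, the algorithm solves broadcast in $T$ rounds with probability at least $p$ (in particular, if it does so on every network of $\mathcal N$), then $$T\ \ge\ \kappa_p\,\min\{\Delta+D,\;1/\phi_{avg}\}$$ for (the parameters of) every network in $\mathcal N$. -/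

import Mathlib

open scoped Finset

/-- A network: a connected undirected graph whose edges carry positive integer latencies.
(The value of `latency` on pairs that are not edges is irrelevant.) -/
structure LatencyNetwork (V : Type) where
  graph : SimpleGraph V
  connected : graph.Connected
  latency : Sym2 V → ℕ
  latency_pos : ∀ e ∈ graph.edgeSet, 1 ≤ latency e

namespace LatencyNetwork

variable {V : Type}

/-- The length of a walk: the sum of the latencies of its edges. -/
def walkLength (N : LatencyNetwork V) {u v : V} (w : N.graph.Walk u v) : ℕ :=
  (w.edges.map N.latency).sum

/-- Weighted distance: the least length of a walk from `u` to `v`. -/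
noncomputable def wdist (N : LatencyNetwork V) (u v : V) : ℕ :=
  sInf (Set.range fun w : N.graph.Walk u v => N.walkLength w)

/-- Weighted diameter `D`. -/
noncomputable def wdiam [Fintype V] (N : LatencyNetwork V) : ℕ :=
  Finset.univ.sup fun p : V × V => N.wdist p.1 p.2

open Classical in
/-- The set of neighbours of `v`. -/
noncomputable def nbrs [Fintype V] (N : LatencyNetwork V) (v : V) : Finset V :=
  Finset.univ.filter fun w => N.graph.Adj v w

/-- Maximum degree `Δ`. -/
noncomputable def maxDeg [Fintype V] (N : LatencyNetwork V) : ℕ :=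
  Finset.univ.sup fun v => #(N.nbrs v)

/-- `Vol(U)`, the sum of the degrees (in the underlying graph) of the nodes of `U`. -/
noncomputable def vol [Fintype V] (N : LatencyNetwork V) (U : Finset V) : ℕ :=
  ∑ v ∈ U, #(N.nbrs v)

open Classical in
/-- The largest latency `ℓ_max` of an edge. -/
noncomputable def maxLatency [Fintype V] (N : LatencyNetwork V) : ℕ :=
  N.graph.edgeFinset.sup N.latency

/-- The index of the latency class that contains the latency `x`: class `1` consists of the
latencies `1` and `2`, and class `i ≥ 2` of the latencies in `(2 ^ (i - 1), 2 ^ i]`. -/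
def latencyClass (x : ℕ) : ℕ := max 1 (Nat.clog 2 x)

open Classical in
/-- `k_i(C)` for the cut `C = (U, V ∖ U)`: the edges across the cut in latency class `i`,
each of them written as the pair (endpoint in `U`, endpoint outside `U`). -/
noncomputable def cutEdges [Fintype V] (N : LatencyNetwork V) (U : Finset V) (i : ℕ) :
    Finset (V × V) :=
  (U ×ˢ Uᶜ).filter fun e =>
    N.graph.Adj e.1 e.2 ∧ latencyClass (N.latency s(e.1, e.2)) = i

open Classical in
/-- `φ_avg(C)` for the cut `C = (U, V ∖ U)`. The latency classes of the network are those with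
index between `1` and the class of the largest latency. -/
noncomputable def avgCutConductance [Fintype V] (N : LatencyNetwork V) (U : Finset V) : ℝ :=
  (1 / ((min (N.vol U) (N.vol Uᶜ) : ℕ) : ℝ)) *
    ∑ i ∈ Finset.Icc 1 (latencyClass N.maxLatency), (#(N.cutEdges U i) : ℝ) / 2 ^ i

/-- `φ_avg`, the minimum of `φ_avg(C)` over all cuts (both sides non-empty). -/
noncomputable def avgConductance [Fintype V] (N : LatencyNetwork V) : ℝ :=
  sInf {x | ∃ U : Finset V, U.Nonempty ∧ U ≠ Finset.univ ∧ x = N.avgCutConductance U}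

end LatencyNetwork

/-- A deterministic gossip protocol for nodes with identities in `V`. Initially a node knows its
identity, the set of its neighbours, and whether it is the source, but no latencies. In each round
it chooses, from its state, at most one neighbour to exchange messages with (`contact`). When
exchanges of node `v` complete, it updates its state by `receive`, whose last argument
gives, for every neighbour `w` and every round `r`, the message of `w` in the exchange with `w`
that was started in round `r`, if such an exchange is completed just now. -/
structure GossipProtocol (V : Type) where
  State : Type
  Msg : Type
  init : V → Finset V → Bool → State
  contact : State → Option V
  message : State → V → Msg
  receive : State → (V → ℕ → Option Msg) → State

namespace GossipProtocol

variable {V : Type} [Fintype V]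

open Classical in
/-- The state of node `v` at time `t`, i.e. at the beginning of round `t` (rounds are numbered
from `0`). An exchange over the edge `vw` that is started in round `r`, by either endpoint or by
both, completes at time `r + latency vw`, when each endpoint receives the message which the other
one composed in round `r`. A choice of a node that is not a neighbour has no effect. Nodes may
start a new exchange in every round, and they answer all requests. -/
noncomputable def stateAt (P : GossipProtocol V) (N : LatencyNetwork V) (src : V) :
    ℕ → V → P.State
  | 0, v => P.init v (N.nbrs v) (decide (v = src))
  | t + 1, v => P.receive (stateAt P N src t v) fun w r =>
      if _hr : r ≤ t then
        if N.graph.Adj v w ∧ r + N.latency s(v, w) = t + 1 ∧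
            (P.contact (stateAt P N src r v) = some w ∨
              P.contact (stateAt P N src r w) = some v) then
          some (P.message (stateAt P N src r w) v)
        else none
      else none
termination_by t _ => t
decreasing_by all_goals omega

/-- The edge `vw` is activated in round `r` by one of its endpoints. -/
def Exchange (P : GossipProtocol V) (N : LatencyNetwork V) (src : V) (r : ℕ) (v w : V) : Prop :=
  N.graph.Adj v w ∧
    (P.contact (P.stateAt N src r v) = some w ∨ P.contact (P.stateAt N src r w) = some v)

/-- `P.Informed N src v t`: node `v` knows the rumor of `src` after `t` rounds. An exchange passes
the rumor on iff the other endpoint knew it when the exchange was started. -/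
inductive Informed (P : GossipProtocol V) (N : LatencyNetwork V) (src : V) : V → ℕ → Prop
  | source (t : ℕ) : Informed P N src src t
  | exchange {v w : V} {r t : ℕ} (hw : Informed P N src w r) (hx : P.Exchange N src r v w)
      (ht : r + N.latency s(v, w) ≤ t) : Informed P N src v t

end GossipProtocol

/-- A (randomized) gossip algorithm: a probability distribution over deterministic protocols.
The point of `Ω` holds the random bits of all nodes; letting every node see all of them only makes
the class of algorithms larger. -/
structure GossipAlgorithm (V : Type) [Fintype V] where
  Ω : Type
  mΩ : MeasurableSpace Ω
  μ : MeasureTheory.Measure Ω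
  isProb : MeasureTheory.IsProbabilityMeasure μ
  protocol : Ω → GossipProtocol V
  measurable_informed : ∀ (N : LatencyNetwork V) (src v : V) (t : ℕ),
    MeasurableSet {ω | (protocol ω).Informed N src v t}

/-- The probability that all nodes of `N` know the rumor of `src` after `T` rounds. -/
noncomputable def GossipAlgorithm.successProb {V : Type} [Fintype V] (A : GossipAlgorithm V)
    (N : LatencyNetwork V) (src : V) (T : ℕ) : ℝ :=
  (A.μ {ω | ∀ v, (A.protocol ω).Informed N src v T}).toReal

/-! The networks are paths of `m + 1`, about `1 / α`, layers of about `s`, of order `α n`, nodes.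
All pairs in the same or in consecutive layers are adjacent. Edges inside a layer have latency `1`.
In each gap between consecutive layers one hidden edge, chosen independently and uniformly, is fast
(latency `1`), and all other edges of the gap have latency `ℓ`.

Degrees are of order `s`. The fast edges make `D` of order `m`. An isoperimetric inequality for the
layers, together with the cut through the middle of the path, gives `φ_avg` of order `1 / (ℓ (m +
1))`, that is `α / ℓ`. The single fast edge does not spoil the upper bound, since `ℓ = O(s²)` makes
its weight at most of the order of that of all slow edges of the gap (`Layering.le_avgConductance`,
`Layering.avgConductance_le`, `Layering.parameters`).

For the time bound, the rumor has to travel at least `(m + 1) / 4` gaps, so `T ≥ (m + 1) / 4`. If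
moreover `8 T < ℓ (m + 1)`, there is no time to cross half of these gaps over slow edges, so at
least half of their fast edges are activated. Until the hidden edge of a gap is tried, a run carries
no information about it, and only `2 s T` of the `s²` candidates can be tried in `T` rounds. A given
fast edge is thus activated with probability at most `2 T / s`, and by double counting the success
probability is at most `4 T / s` (`Layering.card_fastActivated_mul_le`,
`Layering.card_informed_mul_le`). Hence either `T` is of order `ℓ (m + 1)`, which is at least of
order `1 / φ_avg`, or it is at least of order `s + m`, i.e. `Δ + D`. -/

lemma LatencyNetwork.mem_nbrs {V : Type} [Fintype V] {N : LatencyNetwork V} {v w : V} :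
    w ∈ N.nbrs v ↔ N.graph.Adj v w := by
  simp [nbrs]

/-! ### The layered networks: distances and degrees. -/

/-- A partition of `V` into `m + 1` consecutive layers with at least `s` and at most `2 * s` nodes
each; `node i` lists `s` distinct nodes of layer `i`. -/
structure Layering (V : Type) [Fintype V] (m s : ℕ) where
  lay : V → ℕ
  node : ℕ → Fin s → V
  lay_le : ∀ v, lay v ≤ m
  lay_node : ∀ i ≤ m, ∀ x, lay (node i x) = i
  node_injective : ∀ i ≤ m, Function.Injective (node i)
  card_le : ∀ i, #{v | lay v = i} ≤ 2 * s
  one_le_m : 1 ≤ m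
  one_le_s : 1 ≤ s

namespace Layering

variable {V : Type} [Fintype V] {m s : ℕ} (L : Layering V m s)

/-- Nodes in the same layer or in consecutive layers are adjacent. -/
def graph : SimpleGraph V where
  Adj v w := v ≠ w ∧ L.lay v ≤ L.lay w + 1 ∧ L.lay w ≤ L.lay v + 1
  symm := ⟨fun _ _ h => ⟨h.1.symm, h.2.2, h.2.1⟩⟩
  loopless := ⟨fun _ h => h.1 rfl⟩

open Classical in
/-- Edges inside a layer and the edges of `F` have latency `1`, all others have latency `ℓ`. -/
noncomputable def latency (ℓ : ℕ) (F : Set (Sym2 V)) (e : Sym2 V) : ℕ :=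
  if e ∈ F ∨ (e.map L.lay).IsDiag then 1 else ℓ

/-- The edge between the nodes with indices `x.1` and `x.2` of the layers `i` and `i + 1`. -/
def gapEdge (i : ℕ) (x : Fin s × Fin s) : Sym2 V := s(L.node i x.1, L.node (i + 1) x.2)

/-- One edge between any two consecutive layers, as chosen by `f`. -/
def fastEdges (f : Fin m → Fin s × Fin s) : Set (Sym2 V) :=
  Set.range fun i : Fin m => L.gapEdge i (f i)

variable {L}

lemma graph_adj {v w : V} :
    L.graph.Adj v w ↔ v ≠ w ∧ L.lay v ≤ L.lay w + 1 ∧ L.lay w ≤ L.lay v + 1 := Iff.rfl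

lemma one_le_latency {ℓ : ℕ} (hℓ : 1 ≤ ℓ) (F : Set (Sym2 V)) (e : Sym2 V) :
    1 ≤ L.latency ℓ F e := by
  unfold latency; split_ifs <;> omega

lemma latency_le {ℓ : ℕ} (hℓ : 1 ≤ ℓ) (F : Set (Sym2 V)) (e : Sym2 V) :
    L.latency ℓ F e ≤ ℓ := by
  unfold latency; split_ifs <;> omega

lemma latency_of_mem {ℓ : ℕ} {F : Set (Sym2 V)} {e : Sym2 V} (h : e ∈ F) :
    L.latency ℓ F e = 1 := by
  simp [latency, h]

lemma latency_of_lay_eq {ℓ : ℕ} {F : Set (Sym2 V)} {v w : V} (h : L.lay v = L.lay w) :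
    L.latency ℓ F s(v, w) = 1 := by
  simp [latency, h]

lemma latency_of_notMem {ℓ : ℕ} {F : Set (Sym2 V)} {v w : V} (h : L.lay v ≠ L.lay w)
    (hF : s(v, w) ∉ F) : L.latency ℓ F s(v, w) = ℓ := by
  simp [latency, h, hF]

lemma mem_fastEdges {f : Fin m → Fin s × Fin s} {v w : V} (h : L.lay w = L.lay v + 1) :
    s(v, w) ∈ L.fastEdges f ↔ ∃ hi : L.lay v < m,
      v = L.node (L.lay v) (f ⟨L.lay v, hi⟩).1 ∧ w = L.node (L.lay v + 1) (f ⟨L.lay v, hi⟩).2 := by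
  constructor
  · rintro ⟨i, hi⟩
    have h1 := L.lay_node i i.2.le (f i).1
    have h2 := L.lay_node (i + 1) i.2 (f i).2
    simp only [gapEdge, Sym2.eq_iff] at hi
    rcases hi with ⟨rfl, rfl⟩ | ⟨rfl, rfl⟩
    · simp [h1]
    · omega
  · rintro ⟨hi, h1, h2⟩
    refine ⟨⟨L.lay v, hi⟩, ?_⟩
    simp only [gapEdge]
    rw [← h1, ← h2]

lemma exists_walk_of_lay_eq (ℓ : ℕ) (F : Set (Sym2 V)) {u v : V} (h : L.lay u = L.lay v) :
    ∃ p : L.graph.Walk u v, (p.edges.map (L.latency ℓ F)).sum ≤ 1 := by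
  by_cases huv : u = v
  · subst huv
    exact ⟨.nil, by simp⟩
  · refine ⟨.cons (graph_adj.2 ⟨huv, by omega, by omega⟩) .nil, ?_⟩
    simp [latency_of_lay_eq h]

/-- Each gap is crossed by its fast edge, after at most one step inside the layer to reach it: cost
`2` per gap, plus a final step inside the last layer. -/
lemma exists_walk_of_lay_le (ℓ : ℕ) (f : Fin m → Fin s × Fin s) (u : V) (d : ℕ) :
    ∀ v, L.lay v = L.lay u + d →
      ∃ p : L.graph.Walk u v, (p.edges.map (L.latency ℓ (L.fastEdges f))).sum ≤ 2 * d + 1 := by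
  induction d with
  | zero => exact fun v h => by simpa using exists_walk_of_lay_eq ℓ _ (by omega)
  | succ d ih =>
    intro v h
    have hm : L.lay u + d < m := by have := L.lay_le v; omega
    set i : Fin m := ⟨L.lay u + d, hm⟩
    have hx := L.lay_node i i.2.le (f i).1
    have hy := L.lay_node (i + 1) i.2 (f i).2
    obtain ⟨p, hp⟩ := ih (L.node i (f i).1) hx
    have hadj : L.graph.Adj (L.node i (f i).1) (L.node (i + 1) (f i).2) :=
      graph_adj.2 ⟨fun h => by rw [h] at hx; omega, by omega, by omega⟩
    obtain ⟨q, hq⟩ := exists_walk_of_lay_eq (L := L) ℓ (L.fastEdges f)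
      (u := L.node (i + 1) (f i).2) (v := v) (by simp only [hy, i]; omega)
    refine ⟨p.append (.cons hadj q), ?_⟩
    have he : L.latency ℓ (L.fastEdges f) s(L.node i (f i).1, L.node (i + 1) (f i).2) = 1 :=
      latency_of_mem ⟨i, rfl⟩
    simp only [SimpleGraph.Walk.edges_append, SimpleGraph.Walk.edges_cons, List.map_append,
      List.map_cons, List.sum_append, List.sum_cons, he]
    omega

lemma exists_walk (ℓ : ℕ) (f : Fin m → Fin s × Fin s) (u v : V) :
    ∃ p : L.graph.Walk u v, (p.edges.map (L.latency ℓ (L.fastEdges f))).sum ≤ 2 * m + 1 := by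
  have hu := L.lay_le u
  have hv := L.lay_le v
  rcases le_total (L.lay u) (L.lay v) with h | h
  · obtain ⟨p, hp⟩ := exists_walk_of_lay_le (L := L) ℓ f u (L.lay v - L.lay u) v (by omega)
    exact ⟨p, by omega⟩
  · obtain ⟨p, hp⟩ := exists_walk_of_lay_le (L := L) ℓ f v (L.lay u - L.lay v) u (by omega)
    refine ⟨p.reverse, ?_⟩
    rw [SimpleGraph.Walk.edges_reverse, List.map_reverse, List.sum_reverse]
    omega

variable (L)

lemma connected : L.graph.Connected := by
  have h0 : Fin s := ⟨0, L.one_le_s⟩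
  have : Nonempty V := ⟨L.node 0 h0⟩
  refine ⟨fun u v => ?_⟩
  obtain ⟨p, -⟩ := exists_walk (L := L) 1 (fun _ => (h0, h0)) u v
  exact ⟨p⟩

/-- The network of a layering in which the edges of `F` are fast. -/
noncomputable def network {ℓ : ℕ} (hℓ : 1 ≤ ℓ) (F : Set (Sym2 V)) : LatencyNetwork V where
  graph := L.graph
  connected := L.connected
  latency := L.latency ℓ F
  latency_pos e _ := one_le_latency hℓ F e

variable {ℓ : ℕ} (hℓ : 1 ≤ ℓ) (f : Fin m → Fin s × Fin s) (F : Set (Sym2 V))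

lemma wdiam_le : (L.network hℓ (L.fastEdges f)).wdiam ≤ 2 * m + 1 := by
  refine Finset.sup_le fun x _ => ?_
  obtain ⟨p, hp⟩ := exists_walk (L := L) ℓ f x.1 x.2
  exact (Nat.sInf_le (Set.mem_range_self (f := fun w => (L.network hℓ _).walkLength w) p)).trans hp

lemma lay_le_of_walk {ℓ : ℕ} (hℓ : 1 ≤ ℓ) (F : Set (Sym2 V)) {u v : V} (p : L.graph.Walk u v) :
    L.lay v ≤ L.lay u + (p.edges.map (L.latency ℓ F)).sum := by
  induction p with
  | nil => simp
  | @cons a b c h p ih =>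
    have := one_le_latency (L := L) hℓ F s(a, b)
    have := h.2.2
    simp only [SimpleGraph.Walk.edges_cons, List.map_cons, List.sum_cons]
    omega

lemma le_wdiam : m ≤ (L.network hℓ F).wdiam := by
  have h0 : Fin s := ⟨0, L.one_le_s⟩
  refine le_trans ?_ (Finset.le_sup (Finset.mem_univ (L.node 0 h0, L.node m h0)))
  have : Nonempty ((L.network hℓ F).graph.Walk (L.node 0 h0) (L.node m h0)) :=
    (L.network hℓ F).connected.preconnected _ _
  refine le_csInf (Set.range_nonempty _) ?_
  rintro _ ⟨p, rfl⟩
  have := L.lay_le_of_walk hℓ F p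
  rw [L.lay_node 0 (Nat.zero_le _), L.lay_node m le_rfl] at this
  simpa [LatencyNetwork.walkLength, network] using this

lemma le_card_layer {i : ℕ} (hi : i ≤ m) : s ≤ #{v | L.lay v = i} := by
  simpa using Finset.card_le_card_of_injOn (s := (Finset.univ : Finset (Fin s))) (L.node i)
    (fun x _ => by simpa using L.lay_node i hi x) (L.node_injective i hi).injOn

lemma card_nbrs_le (v : V) : #((L.network hℓ F).nbrs v) ≤ 6 * s := by
  classical
  have h : (L.network hℓ F).nbrs v ⊆ ({w | L.lay w = L.lay v - 1} : Finset V) ∪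
      ({w | L.lay w = L.lay v} : Finset V) ∪ ({w | L.lay w = L.lay v + 1} : Finset V) := by
    intro w hw
    have := (LatencyNetwork.mem_nbrs.1 hw).2
    simp only [Finset.mem_union, Finset.mem_filter_univ]
    omega
  have h1 := L.card_le (L.lay v - 1)
  have h2 := L.card_le (L.lay v)
  have h3 := L.card_le (L.lay v + 1)
  refine (Finset.card_le_card h).trans ((Finset.card_union_le _ _).trans ?_)
  have := Finset.card_union_le ({w | L.lay w = L.lay v - 1} : Finset V)
    ({w | L.lay w = L.lay v} : Finset V)
  omega

/-- A layer next to that of `v` is used, because the own layer only guarantees `s - 1` neighbours.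
-/
lemma le_card_nbrs (v : V) : s ≤ #((L.network hℓ F).nbrs v) := by
  obtain ⟨i, hi, h1, h2, h3⟩ : ∃ i ≤ m, i ≠ L.lay v ∧ i ≤ L.lay v + 1 ∧ L.lay v ≤ i + 1 := by
    have := L.one_le_m
    have := L.lay_le v
    by_cases h : L.lay v = 0
    · exact ⟨1, by omega, by omega, by omega, by omega⟩
    · exact ⟨L.lay v - 1, by omega, by omega, by omega, by omega⟩
  refine (L.le_card_layer hi).trans (Finset.card_le_card fun w hw => ?_)
  simp only [Finset.mem_filter_univ] at hw
  exact LatencyNetwork.mem_nbrs.2 ⟨fun h => by subst h; omega, by omega, by omega⟩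

lemma maxDeg_le : (L.network hℓ F).maxDeg ≤ 6 * s :=
  Finset.sup_le fun v _ => L.card_nbrs_le hℓ F v

lemma le_maxDeg : s ≤ (L.network hℓ F).maxDeg :=
  (L.le_card_nbrs hℓ F (L.node 0 ⟨0, L.one_le_s⟩)).trans
    (Finset.le_sup (f := fun v => #((L.network hℓ F).nbrs v)) (Finset.mem_univ _))

end Layering

/-! ### Runs of one protocol on networks that differ in few latencies. -/

namespace GossipProtocol

variable {V : Type} [Fintype V] {P : GossipProtocol V} {N N' : LatencyNetwork V} {src : V}

lemma Exchange.symm {r : ℕ} {v w : V} (h : P.Exchange N src r v w) : P.Exchange N src r w v :=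
  ⟨h.1.symm, h.2.symm⟩

/-- Two runs agree until an edge whose latencies differ is activated. -/
lemma stateAt_congr (hG : N.graph = N'.graph) {T : ℕ}
    (h : ∀ r < T, ∀ v w, P.Exchange N src r v w → N.latency s(v, w) = N'.latency s(v, w)) :
    ∀ t ≤ T, ∀ v, P.stateAt N src t v = P.stateAt N' src t v := by
  intro t
  induction t using Nat.strong_induction_on with
  | _ t ih =>
    intro ht v
    cases t with
    | zero =>
      have hn : N.nbrs v = N'.nbrs v := by ext; simp [LatencyNetwork.mem_nbrs, hG]
      rw [stateAt, stateAt, hn]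
    | succ t =>
      rw [stateAt, stateAt, ih t (by omega) (by omega) v]
      congr 1
      funext w r
      by_cases hr : r ≤ t
      · simp only [hr, dite_true]
        have e1 := ih r (by omega) (by omega) v
        have e2 := ih r (by omega) (by omega) w
        -- An exchange that completes at time `t + 1` started before `T`, so its edge has the same
        -- latency in both networks and it completes at the same time.
        have key : (N.graph.Adj v w ∧ r + N.latency s(v, w) = t + 1 ∧
            (P.contact (stateAt P N src r v) = some w ∨
              P.contact (stateAt P N src r w) = some v)) ↔
            (N'.graph.Adj v w ∧ r + N'.latency s(v, w) = t + 1 ∧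
            (P.contact (stateAt P N' src r v) = some w ∨
              P.contact (stateAt P N' src r w) = some v)) := by
          rw [← e1, ← e2, ← hG]
          constructor
          · rintro ⟨h1, h2, h3⟩
            exact ⟨h1, (h r (by omega) v w ⟨h1, h3⟩) ▸ h2, h3⟩
          · rintro ⟨h1, h2, h3⟩
            exact ⟨h1, (h r (by omega) v w ⟨h1, h3⟩) ▸ h2, h3⟩
        by_cases hc : N'.graph.Adj v w ∧ r + N'.latency s(v, w) = t + 1 ∧
            (P.contact (stateAt P N' src r v) = some w ∨
              P.contact (stateAt P N' src r w) = some v)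
        · rw [if_pos (key.2 hc), if_pos hc, e2]
        · rw [if_neg (mt key.1 hc), if_neg hc]
      · simp only [hr, dite_false]

/-- If the latencies of two networks differ only on one edge, then this edge is activated before
time `T` in the second network if it is in the first one. -/
lemma exists_exchange_of_latency_eq (hG : N.graph = N'.graph) {v w : V}
    (hlat : ∀ e, e ≠ s(v, w) → N.latency e = N'.latency e) {T : ℕ}
    (h : ∃ r < T, P.Exchange N src r v w) : ∃ r < T, P.Exchange N' src r v w := by
  classical
  -- At the first activation of the edge, the only difference between the networks has not yet been
  -- touched, so both runs are still in the same states.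
  obtain ⟨hr, hx⟩ := Nat.find_spec h
  refine ⟨Nat.find h, hr, hG ▸ hx.1, ?_⟩
  have key := stateAt_congr (P := P) (src := src) hG (T := Nat.find h) (by
    intro r hr' v' w' hx'
    refine hlat _ fun he => Nat.find_min h hr' ⟨hr'.trans hr, ?_⟩
    rcases Sym2.eq_iff.1 he with ⟨rfl, rfl⟩ | ⟨rfl, rfl⟩
    · exact hx'
    · exact hx'.symm) _ le_rfl
  rw [← key, ← key]
  exact hx.2

/-- A potential that varies by at most the latency along every edge activated before time `T`
changes by at most `t` between the source and any node informed at time `t ≤ T`. -/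
lemma Informed.abs_sub_le {pot : V → ℤ} {T : ℕ}
    (h : ∀ r < T, ∀ v w, P.Exchange N src r v w → |pot v - pot w| ≤ N.latency s(v, w))
    {v : V} {t : ℕ} (hv : P.Informed N src v t) (ht : t ≤ T) : |pot v - pot src| ≤ t := by
  induction hv with
  | source t => simp
  | @exchange v w r t hw hx hrt ih =>
    have := N.latency_pos s(v, w) hx.1
    have h1 := ih (by omega)
    have h2 := h r (by omega) v w hx
    have := _root_.abs_sub_le (pot v) (pot w) (pot src)
    zify at hrt
    linarith

end GossipProtocol

/-! ### Averaging over random bits and over hidden edges. -/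

/-- Yao's principle: by linearity of expectation, a bound for the number of networks solved by each
deterministic protocol carries over to randomized algorithms. -/
lemma GossipAlgorithm.sum_successProb_le {V : Type} [Fintype V] (A : GossipAlgorithm V)
    {ι : Type*} [Fintype ι] (N : ι → LatencyNetwork V) (src : V) (T : ℕ) (M : ℝ)
    (h : ∀ P : GossipProtocol V,
      (Set.ncard {i | ∀ v, P.Informed (N i) src v T} : ℝ) ≤ M) :
    ∑ i, A.successProb (N i) src T ≤ M := by
  classical
  let _ := A.mΩ
  have := A.isProb
  have hm : ∀ i, MeasurableSet {ω | ∀ v, (A.protocol ω).Informed (N i) src v T} := fun i => by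
    rw [Set.ofPred_forall]
    exact MeasurableSet.iInter fun v => A.measurable_informed (N i) src v T
  have h1 : ∀ i, A.successProb (N i) src T =
      ∫ ω, Set.indicator {ω | ∀ v, (A.protocol ω).Informed (N i) src v T} 1 ω ∂A.μ := fun i => by
    rw [MeasureTheory.integral_indicator_one (hm i)]; rfl
  have hint : ∀ i, MeasureTheory.Integrable
      (Set.indicator {ω | ∀ v, (A.protocol ω).Informed (N i) src v T} (1 : A.Ω → ℝ)) A.μ :=
    fun i => (MeasureTheory.integrable_const (1 : ℝ)).indicator (hm i)
  simp_rw [h1]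
  rw [← MeasureTheory.integral_finsetSum _ fun i _ => hint i]
  calc _ ≤ ∫ _, M ∂A.μ := by
        refine MeasureTheory.integral_mono (MeasureTheory.integrable_finsetSum _ fun i _ => hint i)
          (MeasureTheory.integrable_const M) fun ω => ?_
        refine le_trans (le_of_eq ?_) (h (A.protocol ω))
        rw [Set.ncard_eq_toFinset_card']
        simp [Set.indicator_apply]
    _ = M := by simp

/-- If, with all coordinates but the `i`-th fixed, at most `M` values of the `i`-th coordinate are
good, then at most a fraction `M / #β` of all functions is good. -/
lemma card_filter_mul_card_le {ι β : Type*} [Fintype ι] [DecidableEq ι] [Fintype β]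
    (good : (ι → β) → Prop) [DecidablePred good] (i : ι) (M : ℕ)
    (h : ∀ f, #{x | good (Function.update f i x)} ≤ M) :
    #{f | good f} * Fintype.card β ≤ M * Fintype.card (ι → β) := by
  -- Exchanging the `i`-th coordinate of a function with a spare value permutes the pairs (function,
  -- value); this turns the count of good functions into the count of good updates.
  have hinv : Function.Involutive
      (fun z : (ι → β) × β => (Function.update z.1 i z.2, z.1 i)) := fun z => by simp
  calc #{f | good f} * Fintype.card β
      = ∑ z : (ι → β) × β, if good z.1 then 1 else 0 := by
        rw [Fintype.sum_prod_type_right]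
        simp [mul_comm]
    _ = ∑ z : (ι → β) × β, if good (Function.update z.1 i z.2) then 1 else 0 :=
        (Fintype.sum_equiv hinv.toPerm _ _ fun z => rfl).symm
    _ = ∑ f : ι → β, #{x | good (Function.update f i x)} := by
        rw [Fintype.sum_prod_type]
        simp
    _ ≤ _ := by
        refine (Finset.sum_le_card_nsmul _ _ M fun f _ => h f).trans ?_
        simp [mul_comm]

/-! ### Conductance as a sum of edge weights. -/

namespace LatencyNetwork

variable {V : Type} [Fintype V] (N : LatencyNetwork V)

lemma latencyClass_mono : Monotone latencyClass := fun _ _ h =>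
  max_le_max le_rfl (Nat.clog_mono_right 2 h)

lemma le_two_pow_latencyClass (x : ℕ) : x ≤ 2 ^ latencyClass x :=
  (Nat.le_pow_clog one_lt_two x).trans (Nat.pow_le_pow_right two_pos (le_max_right _ _))

lemma two_pow_latencyClass_le {x : ℕ} (hx : 1 ≤ x) : 2 ^ latencyClass x ≤ 2 * x := by
  rcases hx.eq_or_lt with rfl | hx
  · simp [latencyClass]
  · have h1 : 1 ≤ Nat.clog 2 x := Nat.clog_pos one_lt_two hx
    have h2 := Nat.pow_pred_clog_lt_self one_lt_two hx
    rw [latencyClass, max_eq_right h1, ← Nat.sub_add_cancel h1, pow_succ]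
    rw [Nat.pred_eq_sub_one] at h2
    omega

open Classical in
/-- The edges across the cut `(U, V ∖ U)`. -/
noncomputable def cut (U : Finset V) : Finset (V × V) :=
  (U ×ˢ Uᶜ).filter fun e => N.graph.Adj e.1 e.2

variable {N} in
lemma mem_cut {U : Finset V} {e : V × V} :
    e ∈ N.cut U ↔ (e.1 ∈ U ∧ e.2 ∉ U) ∧ N.graph.Adj e.1 e.2 := by
  simp [cut]

/-- The cut edges are grouped by class. The classes up to that of the largest latency cover all of
them, by monotonicity of `latencyClass`. -/
lemma avgCutConductance_eq [DecidableEq V] (U : Finset V) :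
    N.avgCutConductance U = (1 / ((min (N.vol U) (N.vol Uᶜ) : ℕ) : ℝ)) *
      ∑ e ∈ N.cut U, 1 / 2 ^ latencyClass (N.latency s(e.1, e.2)) := by
  obtain rfl : ‹DecidableEq V› = Classical.decEq V := Subsingleton.elim _ _
  rw [avgCutConductance]
  congr 1
  rw [← Finset.sum_fiberwise_of_maps_to (s := N.cut U)
    (t := Finset.Icc 1 (latencyClass N.maxLatency))
    (g := fun e => latencyClass (N.latency s(e.1, e.2)))]
  · refine Finset.sum_congr rfl fun i _ => ?_
    have h : N.cutEdges U i = {e ∈ N.cut U | latencyClass (N.latency s(e.1, e.2)) = i} := by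
      ext e
      simp [cutEdges, cut, and_assoc]
    rw [h, Finset.sum_congr rfl (g := fun _ => (1 : ℝ) / 2 ^ i)]
    · simp [div_eq_mul_inv]
    · intro e he
      rw [(Finset.mem_filter.1 he).2]
  · intro e he
    refine Finset.mem_Icc.2 ⟨le_max_left _ _, latencyClass_mono ?_⟩
    exact Finset.le_sup (f := N.latency) (by simpa using (mem_cut.1 he).2)

lemma vol_le {d : ℕ} (h : ∀ v, #(N.nbrs v) ≤ d) (U : Finset V) : N.vol U ≤ #U * d := by
  simpa [vol] using Finset.sum_le_card_nsmul U _ d fun v _ => h v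

lemma le_vol {d : ℕ} (h : ∀ v, d ≤ #(N.nbrs v)) (U : Finset V) : #U * d ≤ N.vol U := by
  simpa [vol] using Finset.card_nsmul_le_sum U _ d fun v _ => h v

end LatencyNetwork

/-! ### Isoperimetry and the lower bound for the conductance. -/

namespace Layering

variable {V : Type} [Fintype V] {m s : ℕ} (L : Layering V m s)

lemma card_eq_sum_layers (U : Finset V) :
    #U = ∑ i ∈ Finset.range (m + 1), #{v ∈ U | L.lay v = i} :=
  Finset.card_eq_sum_card_fiberwise fun v _ => by
    have := L.lay_le v
    simp only [Finset.coe_range, Set.mem_Iio]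
    omega

lemma le_card (L : Layering V m s) : s * (m + 1) ≤ Fintype.card V := by
  have h := Finset.card_nsmul_le_sum (Finset.range (m + 1)) (fun i => #{v | L.lay v = i}) s
    fun i hi => L.le_card_layer (by simpa [Nat.lt_succ_iff] using hi)
  rw [← L.card_eq_sum_layers] at h
  simpa [mul_comm] using h

lemma card_le' (L : Layering V m s) : Fintype.card V ≤ 2 * s * (m + 1) := by
  have h := Finset.sum_le_card_nsmul (Finset.range (m + 1)) (fun i => #{v | L.lay v = i}) (2 * s)
    fun i hi => L.card_le i
  rw [← L.card_eq_sum_layers] at h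
  simpa [mul_comm] using h

lemma card_layer_add [DecidableEq V] (U : Finset V) (i : ℕ) :
    #{v ∈ U | L.lay v = i} + #{v ∈ Uᶜ | L.lay v = i} = #{v | L.lay v = i} := by
  rw [← Finset.card_union_of_disjoint, ← Finset.filter_union, Finset.union_compl]
  exact Finset.disjoint_filter_filter disjoint_compl_right

section cut

variable {ℓ : ℕ} (hℓ : 1 ≤ ℓ) (F : Set (Sym2 V)) (U : Finset V) {i j : ℕ}

lemma mem_cut {e : V × V} : e ∈ (L.network hℓ F).cut U ↔
    (e.1 ∈ U ∧ e.2 ∉ U) ∧ L.lay e.1 ≤ L.lay e.2 + 1 ∧ L.lay e.2 ≤ L.lay e.1 + 1 := by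
  rw [LatencyNetwork.mem_cut]
  refine and_congr_right fun h => ⟨fun h => h.2, fun h' => ⟨fun he => h.2 (he ▸ h.1), h'⟩⟩

/-- The fraction of layer `i` that lies in `U`. -/
noncomputable def frac (U : Finset V) (i : ℕ) : ℝ :=
  #{v ∈ U | L.lay v = i} / #{v | L.lay v = i}

lemma card_layer_pos (hi : i ≤ m) : (0 : ℝ) < #{v | L.lay v = i} := by
  have h1 := L.le_card_layer hi
  have h2 := L.one_le_s
  exact_mod_cast h2.trans h1

lemma frac_nonneg : 0 ≤ L.frac U i := by unfold frac; positivity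

lemma frac_mul (hi : i ≤ m) :
    L.frac U i * #{v | L.lay v = i} = #{v ∈ U | L.lay v = i} :=
  div_mul_cancel₀ _ (L.card_layer_pos hi).ne'

lemma card_le_of_frac_le {M : ℝ} (h : ∀ i ≤ m, L.frac U i ≤ M) :
    (#U : ℝ) ≤ M * Fintype.card V := by
  have hV := L.card_eq_sum_layers Finset.univ
  rw [Finset.card_univ] at hV
  rw [hV, L.card_eq_sum_layers U]
  push_cast
  rw [Finset.mul_sum]
  refine Finset.sum_le_sum fun i hi => ?_
  have hi : i ≤ m := Nat.lt_succ_iff.1 (Finset.mem_range.1 hi)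
  rw [← L.frac_mul U hi]
  exact mul_le_mul_of_nonneg_right (h i hi) (L.card_layer_pos hi).le

variable [DecidableEq V]

lemma card_mul_card_le_cut (i : ℕ) :
    #{v ∈ U | L.lay v = i} * #{v ∈ Uᶜ | L.lay v = i} ≤ #((L.network hℓ F).cut U) := by
  rw [← Finset.card_product]
  refine Finset.card_le_card fun e he => ?_
  simp only [Finset.mem_product, Finset.mem_filter, Finset.mem_compl] at he
  rw [L.mem_cut]
  exact ⟨⟨he.1.1, he.2.1⟩, by omega, by omega⟩

lemma sum_le_cut :
    ∑ i ∈ Finset.range m, (#{v ∈ U | L.lay v = i} * #{v ∈ Uᶜ | L.lay v = i + 1} +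
      #{v ∈ U | L.lay v = i + 1} * #{v ∈ Uᶜ | L.lay v = i}) ≤ #((L.network hℓ F).cut U) := by
  have h : ∀ i, #{v ∈ U | L.lay v = i} * #{v ∈ Uᶜ | L.lay v = i + 1} +
      #{v ∈ U | L.lay v = i + 1} * #{v ∈ Uᶜ | L.lay v = i} =
      #{e ∈ U ×ˢ Uᶜ | L.lay e.1 = i ∧ L.lay e.2 = i + 1 ∨ L.lay e.1 = i + 1 ∧ L.lay e.2 = i} := by
    intro i
    rw [Finset.filter_or, Finset.card_union_of_disjoint, ← Finset.card_product,
      ← Finset.card_product, ← Finset.filter_product, ← Finset.filter_product]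
    refine Finset.disjoint_filter.2 fun e _ h1 h2 => ?_
    omega
  simp_rw [h]
  rw [← Finset.card_biUnion]
  · refine Finset.card_le_card fun e he => ?_
    simp only [Finset.mem_biUnion, Finset.mem_filter, Finset.mem_product, Finset.mem_compl] at he
    obtain ⟨i, -, h1, h2⟩ := he
    rw [L.mem_cut]
    exact ⟨h1, by omega, by omega⟩
  · intro i _ j _ hij
    refine Finset.disjoint_filter.2 fun e _ h1 h2 => ?_
    omega

lemma frac_compl (hi : i ≤ m) : L.frac Uᶜ i = 1 - L.frac U i := by
  have h := L.card_layer_pos hi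
  rw [frac, frac, eq_sub_iff_add_eq, ← add_div, div_eq_one_iff_eq h.ne', add_comm]
  exact_mod_cast L.card_layer_add U i

lemma frac_le_one (hi : i ≤ m) : L.frac U i ≤ 1 := by
  have h1 := L.frac_compl U hi
  have h2 := L.frac_nonneg Uᶜ (i := i)
  linarith

lemma sq_mul_frac_le_card (hi : i ≤ m) (hj : j ≤ m) :
    (s : ℝ) ^ 2 * (L.frac U i * (1 - L.frac U j)) ≤
      #{v ∈ U | L.lay v = i} * #{v ∈ Uᶜ | L.lay v = j} := by
  rw [← L.frac_mul U hi, ← L.frac_mul Uᶜ hj, L.frac_compl U hj]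
  have h1 : (s : ℝ) ≤ #{v | L.lay v = i} := by exact_mod_cast L.le_card_layer hi
  have h2 : (s : ℝ) ≤ #{v | L.lay v = j} := by exact_mod_cast L.le_card_layer hj
  have h3 : 0 ≤ L.frac U i * (1 - L.frac U j) :=
    mul_nonneg (L.frac_nonneg U) (by linarith [L.frac_le_one U hj])
  calc (s : ℝ) ^ 2 * (L.frac U i * (1 - L.frac U j))
      ≤ (#{v | L.lay v = i} * #{v | L.lay v = j}) * (L.frac U i * (1 - L.frac U j)) := by
        refine mul_le_mul_of_nonneg_right ?_ h3
        rw [sq]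
        gcongr
    _ = _ := by ring

/-- If `U` fills fractions `x` and `y` of two consecutive layers, at least `s² (x (1 - y) + y (1 -
x)) ≥ s² |x - y|` edges of that gap are cut. The gaps have disjoint edge sets, so the triangle
inequality along the path finishes. -/
lemma sq_mul_abs_frac_sub_le (hij : i ≤ j) (hj : j ≤ m) :
    (s : ℝ) ^ 2 * |L.frac U i - L.frac U j| ≤ #((L.network hℓ F).cut U) := by
  have h1 := dist_le_Ico_sum_dist (L.frac U) hij
  have h2 : ∑ k ∈ Finset.Ico i j, (s : ℝ) ^ 2 * dist (L.frac U k) (L.frac U (k + 1)) ≤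
      ∑ k ∈ Finset.range m, (s : ℝ) ^ 2 * dist (L.frac U k) (L.frac U (k + 1)) :=
    Finset.sum_le_sum_of_subset_of_nonneg (fun k hk => by
      simp only [Finset.mem_Ico, Finset.mem_range] at *; omega) fun k _ _ => by positivity
  have h3 : ∑ k ∈ Finset.range m, (s : ℝ) ^ 2 * dist (L.frac U k) (L.frac U (k + 1)) ≤
      #((L.network hℓ F).cut U) := by
    have hc : ∑ k ∈ Finset.range m,
        ((#{v ∈ U | L.lay v = k} : ℝ) * #{v ∈ Uᶜ | L.lay v = k + 1} +
          #{v ∈ U | L.lay v = k + 1} * #{v ∈ Uᶜ | L.lay v = k}) ≤ #((L.network hℓ F).cut U) := by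
      exact_mod_cast L.sum_le_cut hℓ F U
    refine le_trans (Finset.sum_le_sum fun k hk => ?_) hc
    have hk : k < m := Finset.mem_range.1 hk
    have e1 := L.sq_mul_frac_le_card U (i := k) (j := k + 1) hk.le hk
    have e2 := L.sq_mul_frac_le_card U (i := k + 1) (j := k) hk hk.le
    refine le_trans ?_ (add_le_add e1 e2)
    rw [← mul_add]
    refine mul_le_mul_of_nonneg_left ?_ (by positivity)
    have a1 := L.frac_nonneg U (i := k)
    have a2 := L.frac_nonneg U (i := k + 1)
    have b1 := L.frac_le_one U (i := k) hk.le
    have b2 := L.frac_le_one U (i := k + 1) hk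
    rw [Real.dist_eq, abs_le]
    constructor <;> nlinarith
  rw [Real.dist_eq] at h1
  calc _ ≤ (s : ℝ) ^ 2 * _ := mul_le_mul_of_nonneg_left h1 (by positivity)
    _ ≤ _ := by rw [Finset.mul_sum]; exact h2.trans h3

/-- The isoperimetric inequality, for a set that fills at most half of some layer. -/
lemma sq_mul_card_le_cut_of_frac_le (hi : i ≤ m) (h : L.frac U i ≤ 1 / 2) :
    (s : ℝ) ^ 2 * #U ≤ 3 * Fintype.card V * #((L.network hℓ F).cut U) := by
  have hs : (0 : ℝ) < s ^ 2 := by have := L.one_le_s; positivity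
  -- Of the factor `3`, two come from the cut edges inside layer `i`, where `x (1 - x) ≥ x / 2`, and
  -- one from the change of the fraction between layers `i` and `j`.
  have key : ∀ j ≤ m, L.frac U j ≤ 3 * #((L.network hℓ F).cut U) / (s : ℝ) ^ 2 := by
    intro j hj
    rw [le_div_iff₀ hs]
    have h1 : (s : ℝ) ^ 2 * |L.frac U i - L.frac U j| ≤ #((L.network hℓ F).cut U) := by
      rcases le_total i j with hij | hij
      · exact L.sq_mul_abs_frac_sub_le hℓ F U hij hj
      · rw [abs_sub_comm]
        exact L.sq_mul_abs_frac_sub_le hℓ F U hij hi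
    have h2 : (s : ℝ) ^ 2 * (L.frac U i * (1 - L.frac U i)) ≤ #((L.network hℓ F).cut U) :=
      (L.sq_mul_frac_le_card U hi hi).trans (by exact_mod_cast L.card_mul_card_le_cut hℓ F U i)
    have h3 : L.frac U i / 2 ≤ L.frac U i * (1 - L.frac U i) := by
      nlinarith [L.frac_nonneg U (i := i)]
    have h4 := mul_le_mul_of_nonneg_left h3 hs.le
    have h5 := mul_le_mul_of_nonneg_left (neg_le_abs (L.frac U i - L.frac U j)) hs.le
    linarith
  have := L.card_le_of_frac_le U key
  rw [div_mul_eq_mul_div, le_div_iff₀ hs] at this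
  linarith

lemma card_cut_compl : #((L.network hℓ F).cut Uᶜ) = #((L.network hℓ F).cut U) := by
  refine Finset.card_bij (fun e _ => e.swap) (fun e he => ?_) (fun e _ e' _ h => ?_)
    fun e he => ⟨e.swap, ?_, by simp⟩
  · rw [L.mem_cut] at *
    simp only [Finset.mem_compl, Prod.fst_swap, Prod.snd_swap] at *
    tauto
  · exact Prod.swap_injective h
  · rw [L.mem_cut] at *
    simp only [Finset.mem_compl, Prod.fst_swap, Prod.snd_swap] at *
    tauto

/-- The isoperimetric inequality. -/
lemma sq_mul_min_card_le_cut :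
    (s : ℝ) ^ 2 * min #U #Uᶜ ≤ 3 * Fintype.card V * #((L.network hℓ F).cut U) := by
  -- Either `U` or its complement fills at most half of layer `0`, and both have equally many cut
  -- edges.
  rcases le_total (L.frac U 0) (1 / 2) with h | h
  · refine le_trans ?_ (L.sq_mul_card_le_cut_of_frac_le hℓ F U (Nat.zero_le _) h)
    gcongr
    exact min_le_left _ _
  · rw [← L.card_cut_compl]
    refine le_trans ?_ (L.sq_mul_card_le_cut_of_frac_le hℓ F Uᶜ (i := 0) (Nat.zero_le _) ?_)
    · gcongr
      exact min_le_right _ _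
    · rw [L.frac_compl U (Nat.zero_le _)]
      linarith

/-- The constant is `72 = 6 * 2 * 6`: degrees are at most `6 s`, weights at least `1 / (2 ℓ)`, and
isoperimetry with `#V ≤ 2 s (m + 1)` loses a factor `6`. -/
lemma le_avgCutConductance (h1 : U.Nonempty) (h2 : U ≠ Finset.univ) :
    1 / (72 * (ℓ * (m + 1))) ≤ (L.network hℓ F).avgCutConductance U := by
  have hs : (1 : ℝ) ≤ s := by exact_mod_cast L.one_le_s
  have hl : (1 : ℝ) ≤ ℓ := by exact_mod_cast hℓ
  set μ : ℕ := min #U #Uᶜ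
  have hμ : 1 ≤ μ := le_min h1.card_pos (Finset.card_pos.2 (Finset.nonempty_iff_ne_empty.2
    fun h => h2 (Finset.compl_eq_empty_iff _ |>.1 h)))
  have hμ' : (1 : ℝ) ≤ μ := by exact_mod_cast hμ
  have hvol : min ((L.network hℓ F).vol U) ((L.network hℓ F).vol Uᶜ) ≤ μ * (6 * s) := by
    rw [← Nat.mul_min_mul_right]
    exact min_le_min (LatencyNetwork.vol_le _ (L.card_nbrs_le hℓ F) U)
      (LatencyNetwork.vol_le _ (L.card_nbrs_le hℓ F) Uᶜ)
  have hvol' : 1 ≤ min ((L.network hℓ F).vol U) ((L.network hℓ F).vol Uᶜ) := by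
    refine le_trans ?_ (min_le_min (LatencyNetwork.le_vol _ (L.le_card_nbrs hℓ F) U)
      (LatencyNetwork.le_vol _ (L.le_card_nbrs hℓ F) Uᶜ))
    rw [Nat.mul_min_mul_right]
    exact Nat.mul_pos hμ L.one_le_s
  have hcut : (#((L.network hℓ F).cut U) : ℝ) / (2 * ℓ) ≤ ∑ e ∈ (L.network hℓ F).cut U,
      1 / 2 ^ LatencyNetwork.latencyClass ((L.network hℓ F).latency s(e.1, e.2)) := by
    rw [div_eq_mul_one_div, ← nsmul_eq_mul]
    refine Finset.card_nsmul_le_sum _ _ _ fun e _ => one_div_le_one_div_of_le (by positivity) ?_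
    have e1 := LatencyNetwork.two_pow_latencyClass_le (one_le_latency (L := L) hℓ F s(e.1, e.2))
    have e2 := latency_le (L := L) hℓ F s(e.1, e.2)
    exact_mod_cast e1.trans (Nat.mul_le_mul_left 2 e2)
  have hiso := L.sq_mul_min_card_le_cut hℓ F U
  have hV : (Fintype.card V : ℝ) ≤ 2 * s * (m + 1) := by exact_mod_cast L.card_le'
  have hiso' : (s : ℝ) ^ 2 * μ ≤ 3 * (2 * s * (m + 1)) * #((L.network hℓ F).cut U) := by
    refine le_trans ?_ (hiso.trans (by gcongr))
    simp [μ]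
  have hiso'' : (s : ℝ) * μ ≤ 6 * (m + 1) * #((L.network hℓ F).cut U) := by
    have h : (s : ℝ) * (s * μ) ≤ s * (6 * (m + 1) * #((L.network hℓ F).cut U)) := by linarith
    exact le_of_mul_le_mul_left h (by linarith)
  rw [LatencyNetwork.avgCutConductance_eq]
  have hvolr : ((min ((L.network hℓ F).vol U) ((L.network hℓ F).vol Uᶜ) : ℕ) : ℝ) ≤
      μ * (6 * s) := by exact_mod_cast hvol
  have hvolr' : (0 : ℝ) < ((min ((L.network hℓ F).vol U) ((L.network hℓ F).vol Uᶜ) : ℕ) : ℝ) := by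
    exact_mod_cast hvol'
  refine le_trans ?_ (mul_le_mul (one_div_le_one_div_of_le hvolr' hvolr) hcut (by positivity)
    (by positivity))
  rw [div_mul_div_comm, div_le_div_iff₀ (by positivity) (by positivity)]
  nlinarith [mul_le_mul_of_nonneg_left hiso'' (by linarith : (0 : ℝ) ≤ 12 * ℓ)]

end cut

end Layering

/-! ### The middle cut and the upper bound for the conductance. -/

namespace Layering

variable {V : Type} [Fintype V] {m s : ℕ} (L : Layering V m s)

lemma card_mul_le_card {I : Finset ℕ} (hI : ∀ i ∈ I, i ≤ m) : #I * s ≤ #{v | L.lay v ∈ I} := by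
  rw [Finset.card_eq_sum_card_fiberwise (f := L.lay) (t := I) fun v hv => by simpa using hv]
  refine Finset.card_nsmul_le_sum I _ s fun i hi => (L.le_card_layer (hI i hi)).trans
    (Finset.card_le_card fun v hv => ?_)
  simp only [Finset.mem_filter, Finset.mem_univ, true_and] at hv ⊢
  exact ⟨hv ▸ hi, hv⟩

variable {ℓ : ℕ} (hℓ : 1 ≤ ℓ) (f : Fin m → Fin s × Fin s) (F : Set (Sym2 V))

lemma card_fast_le_one (i : ℕ) [DecidablePred (· ∈ L.fastEdges f)] :
    #{e : V × V | (L.lay e.1 = i ∧ L.lay e.2 = i + 1) ∧ s(e.1, e.2) ∈ L.fastEdges f} ≤ 1 := by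
  rw [Finset.card_le_one]
  rintro ⟨v, w⟩ h ⟨v', w'⟩ h'
  simp only [Finset.mem_filter_univ] at h h'
  obtain ⟨⟨h1, h2⟩, h3⟩ := h
  obtain ⟨⟨h1', h2'⟩, h3'⟩ := h'
  rw [mem_fastEdges (by omega)] at h3 h3'
  obtain ⟨_, e1, e2⟩ := h3
  obtain ⟨_, e1', e2'⟩ := h3'
  simp only [h1] at e1 e2
  simp only [h1'] at e1' e2'
  rw [e1, e2, e1', e2']

lemma exists_avgCutConductance_le : ∃ U : Finset V, U.Nonempty ∧ U ≠ Finset.univ ∧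
    (L.network hℓ (L.fastEdges f)).avgCutConductance U ≤
      3 * (4 * s ^ 2 / ℓ + 1) / ((m + 1) * s ^ 2) := by
  classical
  have hs := L.one_le_s
  have hm := L.one_le_m
  -- Both sides of the cut have at least `h` layers, and `m + 1 ≤ 3 * h` because `m ≥ 1`; hence the
  -- factor `3` in the bound.
  set h := (m + 1) / 2 with hh
  set U : Finset V := {v | L.lay v ∈ Finset.range h} with hU
  have hUc : Uᶜ = ({v | L.lay v ∈ Finset.Ico h (m + 1)} : Finset V) := by
    ext v
    have := L.lay_le v
    simp only [hU, Finset.compl_filter, Finset.mem_filter_univ, Finset.mem_range, Finset.mem_Ico]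
    omega
  have cU : h * s ≤ #U := by
    refine le_trans (by rw [Finset.card_range])
      (L.card_mul_le_card (I := Finset.range h) fun i hi => by
        have := Finset.mem_range.1 hi; omega)
  have cUc : h * s ≤ #Uᶜ := by
    rw [hUc]
    refine le_trans ?_ (L.card_mul_le_card (I := Finset.Ico h (m + 1)) fun i hi => by
      have := Finset.mem_Ico.1 hi; omega)
    rw [Nat.card_Ico]
    exact Nat.mul_le_mul_right s (by omega)
  have hpos : 0 < h * s := Nat.mul_pos (by omega) hs
  refine ⟨U, Finset.card_pos.1 (hpos.trans_le cU), fun h => ?_, ?_⟩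
  · rw [h, Finset.compl_univ, Finset.card_empty] at cUc
    omega
  set N := L.network hℓ (L.fastEdges f) with hN
  have hcut : N.cut U ⊆ ({v | L.lay v = h - 1} : Finset V) ×ˢ ({v | L.lay v = h} : Finset V) := by
    intro e he
    rw [hN, L.mem_cut] at he
    simp only [hU, Finset.mem_filter_univ, Finset.mem_range, Finset.mem_product] at he ⊢
    omega
  have hcard : #(N.cut U) ≤ 4 * s ^ 2 := by
    refine (Finset.card_le_card hcut).trans ?_
    rw [Finset.card_product]
    exact (Nat.mul_le_mul (L.card_le _) (L.card_le _)).trans_eq (by ring)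
  have hfast : #{e ∈ N.cut U | s(e.1, e.2) ∈ L.fastEdges f} ≤ 1 := by
    refine le_trans (Finset.card_le_card fun e he => ?_) (L.card_fast_le_one f (h - 1))
    have he' := Finset.mem_filter.1 he
    have := hcut he'.1
    simp only [Finset.mem_product, Finset.mem_filter_univ] at this ⊢
    exact ⟨⟨this.1, by omega⟩, he'.2⟩
  have hl : (0 : ℝ) < ℓ := by exact_mod_cast hℓ
  have hsum : ∑ e ∈ N.cut U, (1 : ℝ) / 2 ^ LatencyNetwork.latencyClass (N.latency s(e.1, e.2)) ≤
      4 * s ^ 2 / ℓ + 1 := by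
    calc _ ≤ ∑ e ∈ N.cut U, ((1 : ℝ) / ℓ + if s(e.1, e.2) ∈ L.fastEdges f then 1 else 0) := by
          refine Finset.sum_le_sum fun e he => ?_
          split_ifs with hF
          · have : (1 : ℝ) / 2 ^ LatencyNetwork.latencyClass (N.latency s(e.1, e.2)) ≤ 1 :=
              div_le_one_of_le₀ (one_le_pow₀ one_le_two) (by positivity)
            have : (0 : ℝ) ≤ 1 / ℓ := by positivity
            linarith
          · rw [add_zero]
            refine one_div_le_one_div_of_le hl ?_
            have hlat : N.latency s(e.1, e.2) = ℓ := by
              have := hcut he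
              simp only [Finset.mem_product, Finset.mem_filter_univ] at this
              exact latency_of_notMem (by omega) hF
            rw [hlat]
            exact_mod_cast LatencyNetwork.le_two_pow_latencyClass ℓ
      _ = #(N.cut U) / ℓ + #{e ∈ N.cut U | s(e.1, e.2) ∈ L.fastEdges f} := by
          rw [Finset.sum_add_distrib]
          simp [div_eq_mul_inv]
      _ ≤ _ := by
          gcongr
          · exact_mod_cast hcard
          · exact_mod_cast hfast
  have hvol : h * s * s ≤ min (N.vol U) (N.vol Uᶜ) :=
    le_min ((Nat.mul_le_mul_right s cU).trans (N.le_vol (L.le_card_nbrs hℓ _) U))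
      ((Nat.mul_le_mul_right s cUc).trans (N.le_vol (L.le_card_nbrs hℓ _) Uᶜ))
  have hvol' : ((m : ℝ) + 1) * s ^ 2 / 3 ≤ ((min (N.vol U) (N.vol Uᶜ) : ℕ) : ℝ) := by
    have h3 : m + 1 ≤ 3 * h := by omega
    have h3' : ((m : ℝ) + 1) ≤ 3 * h := by exact_mod_cast h3
    have hvolr : (h : ℝ) * s * s ≤ ((min (N.vol U) (N.vol Uᶜ) : ℕ) : ℝ) := by exact_mod_cast hvol
    nlinarith [mul_le_mul_of_nonneg_right h3' (sq_nonneg (s : ℝ))]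
  have hs' : (0 : ℝ) < s := by exact_mod_cast hs
  rw [LatencyNetwork.avgCutConductance_eq]
  refine (mul_le_mul (one_div_le_one_div_of_le (by positivity) hvol') hsum
    (Finset.sum_nonneg fun e _ => by positivity) (by positivity)).trans_eq ?_
  field_simp

lemma le_avgConductance :
    1 / (72 * (ℓ * (m + 1))) ≤ (L.network hℓ (L.fastEdges f)).avgConductance := by
  classical
  obtain ⟨U, h1, h2, -⟩ := L.exists_avgCutConductance_le hℓ f
  refine le_csInf ⟨_, U, h1, h2, rfl⟩ ?_
  rintro _ ⟨U, h1, h2, rfl⟩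
  exact L.le_avgCutConductance hℓ _ U h1 h2

lemma avgConductance_le : (L.network hℓ (L.fastEdges f)).avgConductance ≤
    3 * (4 * s ^ 2 / ℓ + 1) / ((m + 1) * s ^ 2) := by
  classical
  obtain ⟨U, h1, h2, h3⟩ := L.exists_avgCutConductance_le hℓ f
  refine le_trans (csInf_le ?_ ?_) h3
  · refine ⟨0, ?_⟩
    rintro _ ⟨U, h1, h2, rfl⟩
    exact le_trans (by positivity) (L.le_avgCutConductance hℓ _ U h1 h2)
  · exact ⟨U, h1, h2, rfl⟩

/-- For `ℓ ≥ 2` the latencies reveal the fast edges, so a uniform network of the class is the same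
as a uniform `f`. -/
lemma network_injective (h2 : 2 ≤ ℓ) :
    Function.Injective fun f : Fin m → Fin s × Fin s => L.network hℓ (L.fastEdges f) := by
  intro f g hfg
  funext i
  have hlat : L.latency ℓ (L.fastEdges f) (L.gapEdge i (f i)) =
      L.latency ℓ (L.fastEdges g) (L.gapEdge i (f i)) :=
    congrFun (congrArg LatencyNetwork.latency hfg) _
  have h1 := L.lay_node i i.2.le (f i).1
  have h2 := L.lay_node (i + 1) i.2 (f i).2
  have hf : L.gapEdge i (f i) ∈ L.fastEdges f := ⟨i, rfl⟩
  rw [latency_of_mem hf, gapEdge] at hlat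
  have hmem : s(L.node i (f i).1, L.node (i + 1) (f i).2) ∈ L.fastEdges g := by
    by_contra hmem
    rw [latency_of_notMem (by omega) hmem] at hlat
    omega
  rw [mem_fastEdges (by omega)] at hmem
  obtain ⟨_, e1, e2⟩ := hmem
  simp only [h1] at e1 e2
  exact Prod.ext (L.node_injective i i.2.le e1) (L.node_injective (i + 1) i.2 e2)

/-! ### How likely a hidden fast edge is to be activated. -/

section protocol

variable (P : GossipProtocol V) (src : V) (T : ℕ)

/-- The fast edge of gap `i` is activated before time `T`. -/
def FastActivated (f : Fin m → Fin s × Fin s) (i : Fin m) : Prop :=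
  ∃ r < T, P.Exchange (L.network hℓ (L.fastEdges f)) src r (L.node i (f i).1)
    (L.node (i + 1) (f i).2)

/-- In each round, each of the `2 s` listed nodes of the two layers contacts at most one node. -/
lemma ncard_activated_le (N : LatencyNetwork V) (i : ℕ) (hi : i + 1 ≤ m) :
    Set.ncard {x : Fin s × Fin s | ∃ r < T, P.Exchange N src r (L.node i x.1) (L.node (i + 1) x.2)}
      ≤ 2 * s * T := by
  classical
  rw [Set.ncard_eq_toFinset_card']
  have hsub : Set.toFinset {x : Fin s × Fin s |
      ∃ r < T, P.Exchange N src r (L.node i x.1) (L.node (i + 1) x.2)} ⊆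
      (Finset.range T).biUnion fun r =>
        ({x | P.contact (P.stateAt N src r (L.node i x.1)) = some (L.node (i + 1) x.2)} :
          Finset (Fin s × Fin s)) ∪
        ({x | P.contact (P.stateAt N src r (L.node (i + 1) x.2)) = some (L.node i x.1)} :
          Finset (Fin s × Fin s)) := by
    intro x hx
    simp only [Set.mem_toFinset, Set.mem_ofPred_eq] at hx
    obtain ⟨r, hr, hx⟩ := hx
    simp only [Finset.mem_biUnion, Finset.mem_range, Finset.mem_union, Finset.mem_filter_univ]
    exact ⟨r, hr, hx.2⟩
  refine (Finset.card_le_card hsub).trans ((Finset.card_biUnion_le_card_mul _ _ (2 * s)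
    fun r _ => (Finset.card_union_le _ _).trans ?_).trans_eq ?_)
  · rw [two_mul]
    refine add_le_add ?_ ?_
    · refine (Finset.card_le_card_of_injOn Prod.fst (t := Finset.univ) (by simp) ?_).trans_eq
        (by simp)
      intro x hx y hy hxy
      simp only [Finset.coe_filter, Finset.mem_univ, true_and, Set.mem_ofPred_eq] at hx hy
      rw [hxy, hy, Option.some_inj] at hx
      exact Prod.ext hxy (L.node_injective (i + 1) hi hx).symm
    · refine (Finset.card_le_card_of_injOn Prod.snd (t := Finset.univ) (by simp) ?_).trans_eq
        (by simp)
      intro x hx y hy hxy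
      simp only [Finset.coe_filter, Finset.mem_univ, true_and, Set.mem_ofPred_eq] at hx hy
      rw [hxy, hy, Option.some_inj] at hx
      exact Prod.ext (L.node_injective i (by omega) hx).symm hxy
  · rw [Finset.card_range, mul_comm]

lemma gapEdge_injective {i j : Fin m} {x y : Fin s × Fin s}
    (h : L.gapEdge i x = L.gapEdge j y) : i = j := by
  have h1 := L.lay_node i i.2.le x.1
  have h2 := L.lay_node (i + 1) i.2 x.2
  have h3 := L.lay_node j j.2.le y.1
  have h4 := L.lay_node (j + 1) j.2 y.2
  rcases Sym2.eq_iff.1 h with ⟨e, -⟩ | ⟨e, e'⟩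
  · rw [e] at h1; ext; omega
  · rw [e] at h1; rw [e'] at h2; omega

lemma latency_congr {F F' : Set (Sym2 V)} {e : Sym2 V} (h : e ∈ F ↔ e ∈ F') :
    L.latency ℓ F e = L.latency ℓ F' e := by
  unfold latency
  by_cases hF : e ∈ F
  · simp [hF, h.1 hF]
  · simp [hF, mt h.2 hF]

lemma latency_update (i : Fin m) (x : Fin s × Fin s) {e : Sym2 V}
    (hx : e ≠ L.gapEdge i x) :
    L.latency ℓ (L.fastEdges (Function.update f i x)) e =
      L.latency ℓ (L.fastEdges f \ {L.gapEdge i (f i)}) e := by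
  have h : e ∈ L.fastEdges (Function.update f i x) ↔ e ∈ L.fastEdges f \ {L.gapEdge i (f i)} := by
    constructor
    · rintro ⟨j, rfl⟩
      have hj : j ≠ i := by rintro rfl; simp at hx
      simp only [Function.update_of_ne hj]
      exact ⟨⟨j, rfl⟩, fun he => hj (L.gapEdge_injective he)⟩
    · rintro ⟨⟨j, rfl⟩, hj⟩
      have hj : j ≠ i := by rintro rfl; simp at hj
      exact ⟨j, by simp [Function.update_of_ne hj]⟩
  exact L.latency_congr h

open Classical in
-- With the other gaps fixed, the run is compared with the one on the network without a fast edge in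
-- gap `i`. That reference network does not depend on the hidden edge `x`, so the edges it activates
-- before `T` contain every `x` that gets activated when it is the fast one.
lemma card_fastActivated_mul_le (i : Fin m) :
    #{f | L.FastActivated hℓ P src T f i} * (s * s) ≤
      2 * s * T * Fintype.card (Fin m → Fin s × Fin s) := by
  have := card_filter_mul_card_le (fun f => L.FastActivated hℓ P src T f i) i (2 * s * T) fun f => by
    refine le_trans ?_ (L.ncard_activated_le P src T
      (L.network hℓ (L.fastEdges f \ {L.gapEdge i (f i)})) i i.2)
    rw [Set.ncard_eq_toFinset_card']
    refine Finset.card_le_card fun x hx => ?_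
    simp only [Finset.mem_filter_univ, FastActivated, Function.update_self] at hx
    simp only [Set.mem_toFinset, Set.mem_ofPred_eq]
    exact GossipProtocol.exists_exchange_of_latency_eq
      (N := L.network hℓ (L.fastEdges (Function.update f i x)))
      (N' := L.network hℓ (L.fastEdges f \ {L.gapEdge i (f i)})) rfl
      (fun e he => L.latency_update f i x he) hx
  simpa using this

end protocol

end Layering

/-! ### The lower bound for the broadcast time within a layering. -/

namespace Layering

variable {V : Type} [Fintype V] {m s : ℕ} (L : Layering V m s)
  {ℓ : ℕ} (hℓ : 1 ≤ ℓ) (f : Fin m → Fin s × Fin s) {P : GossipProtocol V} {src : V} {T : ℕ}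

/-- Some end of the path of layers is at least half of the path away from the source. -/
lemma exists_far_layer (src : V) : ∃ lo hi, m + 1 ≤ 4 * (hi - lo) ∧
    ∃ v, lo = min (L.lay src) (L.lay v) ∧ hi = max (L.lay src) (L.lay v) := by
  have h0 : Fin s := ⟨0, L.one_le_s⟩
  have hm := L.one_le_m
  have hsrc := L.lay_le src
  by_cases h : 2 * L.lay src ≤ m
  -- The distance is at least `m / 2`, hence at least `(m + 1) / 4` as `m ≥ 1`.
  · refine ⟨L.lay src, m, by omega, L.node m h0, ?_⟩
    rw [L.lay_node m le_rfl]
    omega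
  · refine ⟨0, L.lay src, by omega, L.node 0 h0, ?_⟩
    rw [L.lay_node 0 (Nat.zero_le _)]
    omega

lemma abs_sub_eq_sum_Ico (c : ℕ → ℤ) (hc : ∀ i, 0 ≤ c i) (a b : ℕ) :
    |∑ i ∈ Finset.range a, c i - ∑ i ∈ Finset.range b, c i| =
      ∑ i ∈ Finset.Ico (min a b) (max a b), c i := by
  rcases le_total a b with h | h
  · rw [abs_sub_comm, ← Finset.sum_Ico_eq_sub _ h, min_eq_left h, max_eq_right h,
      abs_of_nonneg (Finset.sum_nonneg fun i _ => hc i)]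
  · rw [← Finset.sum_Ico_eq_sub _ h, min_eq_right h, max_eq_left h,
      abs_of_nonneg (Finset.sum_nonneg fun i _ => hc i)]

/-- If crossing the gap `i` costs at least `c i`, for all exchanges before time `T`, then crossing
several gaps before time `T` costs at least the sum of the `c i`. -/
lemma sum_cost_le {F : Set (Sym2 V)} (c : ℕ → ℤ) (hc : ∀ i, 0 ≤ c i)
    (h : ∀ r < T, ∀ v w, P.Exchange (L.network hℓ F) src r v w → L.lay w = L.lay v + 1 →
      c (L.lay v) ≤ L.latency ℓ F s(v, w))
    {v : V} (hv : P.Informed (L.network hℓ F) src v T) :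
    ∑ i ∈ Finset.Ico (min (L.lay src) (L.lay v)) (max (L.lay src) (L.lay v)), c i ≤ T := by
  rw [min_comm, max_comm, ← abs_sub_eq_sum_Ico c hc]
  refine hv.abs_sub_le (pot := fun v => ∑ i ∈ Finset.range (L.lay v), c i) (T := T) ?_ le_rfl
  intro r hr v w hx
  have hadj : L.graph.Adj v w := hx.1
  rcases lt_trichotomy (L.lay v) (L.lay w) with hvw | hvw | hvw
  · have e : L.lay w = L.lay v + 1 := by have := hadj.2.2; omega
    have := h r hr v w hx e
    rw [e, Finset.sum_range_succ, sub_add_cancel_left, abs_neg, abs_of_nonneg (hc _)]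
    exact this
  · simp [hvw]
  · have e : L.lay v = L.lay w + 1 := by have := hadj.2.1; omega
    have := h r hr w v hx.symm e
    rw [e, Finset.sum_range_succ, add_sub_cancel_left, abs_of_nonneg (hc _), Sym2.eq_swap]
    exact this

lemma le_time_of_informed {F : Set (Sym2 V)}
    (h : ∀ v, P.Informed (L.network hℓ F) src v T) : m + 1 ≤ 4 * T := by
  obtain ⟨lo, hi, h3, v, rfl, rfl⟩ := L.exists_far_layer src
  have := L.sum_cost_le hℓ (fun _ => 1) (fun _ => zero_le_one)
    (fun r _ v w _ _ => by exact_mod_cast one_le_latency hℓ F s(v, w)) (h v)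
  simp at this
  omega

open Classical in
/-- Broadcast in few rounds needs many activated fast edges. -/
lemma le_card_fastActivated {lo hi : ℕ} (h3 : m + 1 ≤ 4 * (hi - lo))
    {v : V} (hlo : lo = min (L.lay src) (L.lay v)) (hhi : hi = max (L.lay src) (L.lay v))
    (h : P.Informed (L.network hℓ (L.fastEdges f)) src v T) (hT : 8 * T < ℓ * (m + 1)) :
    hi - lo ≤ 2 * #{i : Fin m | (lo ≤ i ∧ (i : ℕ) < hi) ∧ L.FastActivated hℓ P src T f i} := by
  set A : ℕ → Prop := fun i => ∃ hi : i < m, L.FastActivated hℓ P src T f ⟨i, hi⟩ with hA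
  -- Gaps whose fast edge is activated count as free; every exchange across any other gap uses a
  -- slow edge and costs `ℓ`.
  have hsum := L.sum_cost_le hℓ (fun i => if A i then 0 else (ℓ : ℤ))
    (fun i => by split_ifs <;> positivity) (T := T) (src := src) (P := P) (F := L.fastEdges f)
    (by
      intro r hr v w hx hvw
      split_ifs with hAi
      · positivity
      · by_cases hF : s(v, w) ∈ L.fastEdges f
        · rw [mem_fastEdges hvw] at hF
          obtain ⟨hm, e1, e2⟩ := hF
          refine absurd ⟨hm, r, hr, ?_⟩ hAi
          simp only
          rw [← e1, ← e2]
          exact hx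
        · rw [latency_of_notMem (by omega) hF]) h
  rw [← hlo, ← hhi, Finset.sum_ite, Finset.sum_const_zero, zero_add, Finset.sum_const,
    nsmul_eq_mul] at hsum
  have hslow : #{i ∈ Finset.Ico lo hi | ¬ A i} * ℓ ≤ T := by exact_mod_cast hsum
  have hsplit : #{i ∈ Finset.Ico lo hi | A i} + #{i ∈ Finset.Ico lo hi | ¬ A i} = hi - lo := by
    rw [← Nat.card_Ico]
    convert Finset.card_filter_add_card_filter_not (s := Finset.Ico lo hi) A
  have hfast : #{i ∈ Finset.Ico lo hi | A i} ≤
      #{i : Fin m | (lo ≤ i ∧ (i : ℕ) < hi) ∧ L.FastActivated hℓ P src T f i} := by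
    rw [← Finset.card_map Fin.valEmbedding]
    refine Finset.card_le_card fun i hi => ?_
    obtain ⟨hi1, hm, hi2⟩ := Finset.mem_filter.1 hi
    exact Finset.mem_map.2 ⟨⟨i, hm⟩, by simpa using ⟨Finset.mem_Ico.1 hi1, hi2⟩, rfl⟩
  -- The slow crossings take `ℓ` rounds each within `T`, while `8 T < ℓ (m + 1) ≤ 4 ℓ (hi - lo)`.
  have : 2 * #{i ∈ Finset.Ico lo hi | ¬ A i} < hi - lo := by
    refine lt_of_mul_lt_mul_right (a := 4 * ℓ) ?_ (Nat.zero_le _)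
    have := Nat.mul_le_mul_left ℓ h3
    linarith
  omega

open Classical in
/-- A protocol solves broadcast in few rounds only for a small fraction of the networks. -/
lemma card_informed_mul_le (P : GossipProtocol V) (src : V) (hT : 8 * T < ℓ * (m + 1)) :
    #{f | ∀ v, P.Informed (L.network hℓ (L.fastEdges f)) src v T} * s ≤
      4 * T * Fintype.card (Fin m → Fin s × Fin s) := by
  obtain ⟨lo, hi, h3, v, hlo, hhi⟩ := L.exists_far_layer src
  set S : Finset (Fin m → Fin s × Fin s) :=
    {f | ∀ v, P.Informed (L.network hℓ (L.fastEdges f)) src v T}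
  set I : Finset (Fin m) := {i | lo ≤ i ∧ (i : ℕ) < hi} with hI
  have hIcard : #I ≤ hi - lo := by
    rw [← Finset.card_map Fin.valEmbedding, ← Nat.card_Ico]
    refine Finset.card_le_card fun i hi => ?_
    obtain ⟨j, hj, rfl⟩ := Finset.mem_map.1 hi
    simpa [hI] using hj
  -- Double counting of the pairs (network, gap with activated fast edge).
  have key : #S * (hi - lo) ≤ 2 * ∑ i ∈ I, #{f | L.FastActivated hℓ P src T f i} := by
    calc #S * (hi - lo) ≤ ∑ f ∈ S, 2 * #{i ∈ I | L.FastActivated hℓ P src T f i} := by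
          refine Finset.card_nsmul_le_sum _ _ _ fun f hf => ?_
          rw [hI, Finset.filter_filter]
          exact L.le_card_fastActivated hℓ f h3 hlo hhi ((Finset.mem_filter.1 hf).2 v) hT
      _ ≤ ∑ f, 2 * #{i ∈ I | L.FastActivated hℓ P src T f i} :=
          Finset.sum_le_sum_of_subset (Finset.subset_univ _)
      _ = 2 * ∑ i ∈ I, #{f | L.FastActivated hℓ P src T f i} := by
          rw [← Finset.mul_sum]
          simp_rw [Finset.card_filter]
          rw [Finset.sum_comm]
  have hs := L.one_le_s
  have hsum : (∑ i ∈ I, #{f | L.FastActivated hℓ P src T f i}) * (s * s) ≤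
      (hi - lo) * (2 * s * T * Fintype.card (Fin m → Fin s × Fin s)) := by
    rw [Finset.sum_mul]
    exact (Finset.sum_le_card_nsmul _ _ _ fun i _ =>
      L.card_fastActivated_mul_le hℓ P src T i).trans (Nat.mul_le_mul_right _ hIcard)
  have hd : 0 < (hi - lo) * s := Nat.mul_pos (by omega) hs
  refine le_of_mul_le_mul_right (a := (hi - lo) * s) ?_ hd
  have := Nat.mul_le_mul_right (s * s) key
  nlinarith

open Classical in
/-- The class of the networks of the layering, for all choices of the fast edges. -/
noncomputable def networks : Finset (LatencyNetwork V) :=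
  Finset.univ.image fun f : Fin m → Fin s × Fin s => L.network hℓ (L.fastEdges f)

lemma networks_nonempty : (L.networks hℓ).Nonempty := by
  have h0 : Fin s := ⟨0, L.one_le_s⟩
  have : Nonempty (Fin m → Fin s × Fin s) := ⟨fun _ => (h0, h0)⟩
  classical exact Finset.univ_nonempty.image _

lemma mem_networks {N : LatencyNetwork V} :
    N ∈ L.networks hℓ ↔ ∃ f, L.network hℓ (L.fastEdges f) = N := by
  simp [networks]

variable (A : GossipAlgorithm V) {p : ℝ}

/-- A positive average yields one network and one outcome of the random bits for which broadcast
succeeds; the distance bound applies to that run. -/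
lemma le_time_of_successProb (hp : 0 < p)
    (h : p ≤ (∑ N ∈ L.networks hℓ, A.successProb N src T) / #(L.networks hℓ)) :
    m + 1 ≤ 4 * T := by
  obtain ⟨N, hN, hpos⟩ : ∃ N ∈ L.networks hℓ, A.successProb N src T ≠ 0 := by
    by_contra! h0
    rw [Finset.sum_eq_zero h0, zero_div] at h
    linarith
  obtain ⟨f, rfl⟩ := (L.mem_networks hℓ).1 hN
  obtain ⟨ω, hω⟩ : {ω | ∀ v, (A.protocol ω).Informed
      (L.network hℓ (L.fastEdges f)) src v T}.Nonempty := by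
    rw [Set.nonempty_iff_ne_empty]
    intro he
    rw [GossipAlgorithm.successProb, he] at hpos
    simp at hpos
  exact L.le_time_of_informed hℓ hω

lemma mul_le_time_of_successProb (h2 : 2 ≤ ℓ) (hT : 8 * T < ℓ * (m + 1))
    (h : p ≤ (∑ N ∈ L.networks hℓ, A.successProb N src T) / #(L.networks hℓ)) :
    p * s ≤ 4 * T := by
  classical
  have hs : (0 : ℝ) < s := by exact_mod_cast L.one_le_s
  have hpos : (0 : ℝ) < #(L.networks hℓ) := by exact_mod_cast (L.networks_nonempty hℓ).card_pos
  have hcard : #(L.networks hℓ) = Fintype.card (Fin m → Fin s × Fin s) :=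
    Finset.card_image_of_injective _ (L.network_injective hℓ h2)
  have hsum : ∑ N ∈ L.networks hℓ, A.successProb N src T =
      ∑ f, A.successProb (L.network hℓ (L.fastEdges f)) src T :=
    Finset.sum_image fun _ _ _ _ h => L.network_injective hℓ h2 h
  have hle := A.sum_successProb_le (fun f => L.network hℓ (L.fastEdges f)) src T
    (4 * T * Fintype.card (Fin m → Fin s × Fin s) / s) fun P => by
      rw [le_div_iff₀ hs, Set.ncard_eq_toFinset_card', Set.toFinset_ofPred]
      exact_mod_cast L.card_informed_mul_le hℓ P src hT
  rw [le_div_iff₀ hpos, hsum] at h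
  have := h.trans hle
  rw [le_div_iff₀ hs, ← hcard] at this
  exact le_of_mul_le_mul_right (a := (#(L.networks hℓ) : ℝ)) (by linarith) hpos

end Layering

/-! ### Existence of layerings and the choice of the number of layers. -/

/-- The layers of `Fin M` are the residue classes modulo `m + 1`. -/
def Layering.residues (M m : ℕ) (hm : 1 ≤ m) (hM : m + 1 ≤ M) :
    Layering (Fin M) m (M / (m + 1)) where
  lay v := v % (m + 1)
  -- The default `0` is never taken for `i ≤ m`, the only indices that matter.
  node i x := if h : i + (m + 1) * x < M then ⟨i + (m + 1) * x, h⟩ else ⟨0, by omega⟩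
  lay_le v := Nat.lt_succ_iff.1 (Nat.mod_lt _ (Nat.succ_pos _))
  lay_node i hi x := by
    have hx : (m + 1) * (x + 1) ≤ M :=
      (Nat.mul_le_mul_left _ x.2).trans (Nat.mul_div_le M (m + 1))
    rw [dif_pos (by rw [mul_add] at hx; omega)]
    simp only [Nat.add_mul_mod_self_left]
    exact Nat.mod_eq_of_lt (by omega)
  node_injective i hi x y hxy := by
    have h : ∀ z : Fin (M / (m + 1)), i + (m + 1) * z < M := fun z => by
      have hz : (m + 1) * (z + 1) ≤ M :=
        (Nat.mul_le_mul_left _ z.2).trans (Nat.mul_div_le M (m + 1))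
      rw [mul_add] at hz
      omega
    simp only [dif_pos (h x), dif_pos (h y), Fin.mk.injEq, add_right_inj] at hxy
    exact Fin.ext (Nat.eq_of_mul_eq_mul_left (Nat.succ_pos m) hxy)
  card_le i := by
    have hpos : 1 ≤ M / (m + 1) := Nat.div_pos hM (Nat.succ_pos m)
    refine (Finset.card_le_card_of_injOn (fun v : Fin M => (v : ℕ) / (m + 1))
      (t := Finset.range (M / (m + 1) + 1)) (fun v _ => ?_) fun v hv w hw h => ?_).trans ?_
    · simpa [Nat.lt_succ_iff] using Nat.div_le_div_right v.2.le
    · simp only [Finset.coe_filter, Finset.mem_univ, true_and, Set.mem_ofPred_eq] at hv hw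
      rw [Fin.ext_iff, ← Nat.div_add_mod v (m + 1), ← Nat.div_add_mod w (m + 1), hv, hw]
      simp only at h
      rw [h]
    -- A residue class has at most `M / (m + 1) + 1` elements, which is at most twice the quotient
    -- since the quotient is positive.
    · rw [Finset.card_range]
      omega
  one_le_m := hm
  one_le_s := Nat.div_pos hM (Nat.succ_pos m)

/-- A number of layers of order `1 / α`. -/
lemma exists_number_of_layers {a b α : ℝ} (ha : 0 < a) {n : ℕ} (hn : 1 ≤ n)
    (hα : a / n ≤ α) (hαb : α ≤ b) : ∃ m : ℕ, 1 ≤ m ∧ m + 1 ≤ 2 * n ∧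
      min 1 (2 * a) ≤ (m + 1) * α ∧ (m + 1) * α ≤ 2 * b + 1 := by
  have hn' : (0 : ℝ) < n := by exact_mod_cast hn
  have hα0 : 0 < α := (div_pos ha hn').trans_le hα
  have haα : a ≤ α * n := (div_le_iff₀ hn').1 hα
  -- The value `⌈1 / α⌉₊` is clipped so that there are at least two layers and no more layers than
  -- nodes. The clipping is what brings `2 * a` and `2 * b` into the bounds.
  obtain ⟨m, hm⟩ : ∃ m, min (2 * n) (max 2 ⌈1 / α⌉₊) = m + 1 :=
    Nat.exists_eq_succ_of_ne_zero (by omega)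
  have hm' : min (2 * n : ℝ) (max 2 (⌈1 / α⌉₊ : ℝ)) = m + 1 := by exact_mod_cast hm
  have h1 : 1 ≤ ⌈1 / α⌉₊ * α := by
    rw [← div_le_iff₀ hα0]
    exact Nat.le_ceil _
  have h2 : ⌈1 / α⌉₊ * α ≤ 1 + α := by
    have := (Nat.ceil_lt_add_one (one_div_pos.2 hα0).le).le
    calc _ ≤ (1 / α + 1) * α := by gcongr
      _ = 1 + α := by field_simp
  refine ⟨m, by omega, by omega, ?_, ?_⟩
  · rw [← hm']
    rcases min_choice (2 * n : ℝ) (max 2 (⌈1 / α⌉₊ : ℝ)) with h | h <;> rw [h]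
    · exact (min_le_right _ _).trans (by linarith)
    · exact (min_le_left _ _).trans (h1.trans (by gcongr; exact le_max_right _ _))
  · rw [← hm']
    calc _ ≤ max 2 (⌈1 / α⌉₊ : ℝ) * α := by gcongr; exact min_le_right _ _
      _ ≤ _ := by
        rcases max_choice 2 (⌈1 / α⌉₊ : ℝ) with h | h <;> rw [h] <;> linarith

/-! ### Assembly: the time bound and the orders of the parameters. -/

namespace Layering

variable {V : Type} [Fintype V] {m s : ℕ} (L : Layering V m s)
  {ℓ : ℕ} (hℓ : 1 ≤ ℓ)

/-- The lower bound for the broadcast time. -/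
lemma mul_min_le_time (A : GossipAlgorithm V) {src : V} {T : ℕ} {p : ℝ} (hp : 0 < p)
    (h : p ≤ (∑ N ∈ L.networks hℓ, A.successProb N src T) / #(L.networks hℓ))
    {N : LatencyNetwork V} (hN : N ∈ L.networks hℓ) :
    1 / (24 / p + 576) * min ((N.maxDeg : ℝ) + N.wdiam) (1 / N.avgConductance) ≤ T := by
  obtain ⟨f, rfl⟩ := (L.mem_networks hℓ).1 hN
  have hl : (1 : ℝ) ≤ ℓ := by exact_mod_cast hℓ
  have hT : ((m : ℝ) + 1) ≤ 4 * T := by exact_mod_cast L.le_time_of_successProb hℓ A hp h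
  have hp' : 0 < 24 / p := by positivity
  rw [one_div_mul_eq_div, div_le_iff₀ (by positivity)]
  have hT0 : (0 : ℝ) ≤ T * (24 / p) := by positivity
  -- In the slow case `1 / φ_avg ≤ 72 ℓ (m + 1) ≤ 576 T`. Otherwise `Δ + D ≤ 6 s + 2 m + 1`, where
  -- `s ≤ 4 T / p` and `m + 1 ≤ 4 T`.
  by_cases hslow : ℓ * (m + 1) ≤ 8 * T
  · have hslow' : (ℓ : ℝ) * (m + 1) ≤ 8 * T := by exact_mod_cast hslow
    have hφ := one_div_le_one_div_of_le (by positivity) (L.le_avgConductance hℓ f)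
    rw [one_div_one_div] at hφ
    refine (min_le_right _ _).trans (hφ.trans ?_)
    linarith
  -- For `ℓ = 1` the bound `m + 1 ≤ 4 * T` already puts one in the slow case.
  · have h2 : 2 ≤ ℓ := by
      by_contra h2
      obtain rfl : ℓ = 1 := by omega
      have : m + 1 ≤ 4 * T := by exact_mod_cast hT
      omega
    have hs := L.mul_le_time_of_successProb hℓ A h2 (not_le.1 hslow) h
    have hs' : (s : ℝ) ≤ 4 * T / p := by rw [le_div_iff₀ hp]; linarith
    have h1 : (((L.network hℓ (L.fastEdges f)).maxDeg : ℕ) : ℝ) ≤ 6 * s := by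
      exact_mod_cast L.maxDeg_le hℓ _
    have h2 : (((L.network hℓ (L.fastEdges f)).wdiam : ℕ) : ℝ) ≤ 2 * m + 1 := by
      exact_mod_cast L.wdiam_le hℓ f
    refine (min_le_left _ _).trans ?_
    have : T * (24 / p) = 6 * (4 * T / p) := by ring
    have hT0' : (0 : ℝ) ≤ T := by positivity
    linarith

/-- The parameters of the networks of a layering with about `1 / α` layers. -/
lemma parameters {α n C δ B : ℝ} (hα : 0 < α) (hC : 0 < C) (hδ : 0 < δ) (hδ1 : δ ≤ 1) (hB : 1 ≤ B)
    (hn : 0 < n) (h1 : δ ≤ (m + 1) * α) (h2 : (m + 1) * α ≤ B) (h3 : n ≤ s * (m + 1))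
    (h4 : s * (m + 1) ≤ 2 * n) (h5 : ℓ ≤ C * (n ^ 2 * α ^ 2))
    {N : LatencyNetwork V} (hN : N ∈ L.networks hℓ) {E c₁ c₂ : ℝ}
    (hE : E = (12 + 3 * C * B ^ 2) / δ) (hc₁ : c₁ = δ / (144 * B))
    (hc₂ : c₂ = E + 12 / δ + 2 * B * E) :
    (c₁ * (α / ℓ) ≤ N.avgConductance ∧ N.avgConductance ≤ c₂ * (α / ℓ)) ∧
      (c₁ * (α * n) ≤ N.maxDeg ∧ (N.maxDeg : ℝ) ≤ c₂ * (α * n)) ∧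
      (c₁ * (1 / (ℓ * N.avgConductance)) ≤ N.wdiam ∧
        (N.wdiam : ℝ) ≤ c₂ * (1 / (ℓ * N.avgConductance))) := by
  obtain ⟨f, rfl⟩ := (L.mem_networks hℓ).1 hN
  have hl : (0 : ℝ) < ℓ := by exact_mod_cast hℓ
  have hs : (0 : ℝ) < s := by exact_mod_cast L.one_le_s
  have hm : (1 : ℝ) ≤ m := by exact_mod_cast L.one_le_m
  have hB0 : 0 < B := by linarith
  have hφ1 := L.le_avgConductance hℓ f
  have hφ2 := L.avgConductance_le hℓ f
  have hΔ1 : (s : ℝ) ≤ (L.network hℓ (L.fastEdges f)).maxDeg := by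
    exact_mod_cast L.le_maxDeg hℓ _
  have hΔ2 : (((L.network hℓ (L.fastEdges f)).maxDeg : ℕ) : ℝ) ≤ 6 * s := by
    exact_mod_cast L.maxDeg_le hℓ _
  have hD1 : (m : ℝ) ≤ (L.network hℓ (L.fastEdges f)).wdiam := by
    exact_mod_cast L.le_wdiam hℓ _
  have hD2 : (((L.network hℓ (L.fastEdges f)).wdiam : ℕ) : ℝ) ≤ 2 * m + 1 := by
    exact_mod_cast L.wdiam_le hℓ f
  set N := L.network hℓ (L.fastEdges f)
  set φ := N.avgConductance
  have hE0 : 0 < E := by rw [hE]; positivity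
  have hs1 : α * n ≤ B * s := by
    calc α * n ≤ α * (s * (m + 1)) := by gcongr
      _ = (m + 1) * α * s := by ring
      _ ≤ B * s := by gcongr
  have hs2 : δ * s ≤ 2 * (α * n) := by
    calc δ * s ≤ (m + 1) * α * s := by gcongr
      _ = α * (s * (m + 1)) := by ring
      _ ≤ α * (2 * n) := by gcongr
      _ = _ := by ring
  -- Here the upper bound on `ℓ` enters: it makes the term `1` of the fast edge in `hφ2` comparable
  -- with `s² / ℓ`.
  have hls : (ℓ : ℝ) ≤ C * B ^ 2 * s ^ 2 := by
    calc (ℓ : ℝ) ≤ C * (α * n) ^ 2 := h5.trans_eq (by ring)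
      _ ≤ C * (B * s) ^ 2 := by gcongr
      _ = _ := by ring
  have hlow : α / (72 * B * ℓ) ≤ φ := by
    refine le_trans ?_ hφ1
    rw [div_le_div_iff₀ (by positivity) (by positivity)]
    calc α * (72 * (ℓ * (m + 1))) = 72 * ℓ * ((m + 1) * α) := by ring
      _ ≤ 72 * ℓ * B := by gcongr
      _ = _ := by ring
  have hφ0 : 0 < φ := lt_of_lt_of_le (by positivity) hlow
  have hup : φ ≤ E * (α / ℓ) := by
    refine hφ2.trans ?_
    calc 3 * (4 * s ^ 2 / ℓ + 1) / (((m : ℝ) + 1) * s ^ 2)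
        = (12 * s ^ 2 + 3 * ℓ) / (((m : ℝ) + 1) * s ^ 2 * ℓ) := by field_simp; ring
      _ ≤ (12 * s ^ 2 + 3 * (C * B ^ 2 * s ^ 2)) / (((m : ℝ) + 1) * s ^ 2 * ℓ) := by gcongr
      _ = (12 + 3 * C * B ^ 2) / (m + 1) / ℓ := by field_simp
      _ ≤ (12 + 3 * C * B ^ 2) / δ * α / ℓ := by
        gcongr
        rw [div_mul_eq_mul_div, div_le_div_iff₀ (by positivity) hδ]
        have := mul_le_mul_of_nonneg_left h1 (by positivity : 0 ≤ 12 + 3 * C * B ^ 2)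
        linarith
      _ = _ := by rw [hE]; ring
  have hc₁B : c₁ * (144 * B) = δ := by rw [hc₁]; field_simp
  have hc₁0 : 0 < c₁ := by rw [hc₁]; positivity
  have hEc : E ≤ c₂ := by
    have : 0 < 12 / δ := by positivity
    have : 0 < 2 * B * E := by positivity
    linarith
  refine ⟨⟨le_trans ?_ hlow, hup.trans (by gcongr)⟩, ⟨le_trans ?_ hΔ1, hΔ2.trans ?_⟩,
    le_trans ?_ hD1, hD2.trans ?_⟩
  · rw [mul_div_assoc', div_le_div_iff₀ hl (by positivity)]
    have : c₁ * (72 * B) ≤ 1 := by linarith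
    calc c₁ * α * (72 * B * ℓ) = c₁ * (72 * B) * (α * ℓ) := by ring
      _ ≤ 1 * (α * ℓ) := by gcongr
      _ = _ := one_mul _
  · have : c₁ * B ≤ 1 := by linarith
    calc c₁ * (α * n) ≤ c₁ * (B * s) := by gcongr
      _ = c₁ * B * s := by ring
      _ ≤ 1 * s := by gcongr
      _ = s := one_mul _
  · have h12 : 12 / δ ≤ c₂ := by
      have : 0 < 2 * B * E := by positivity
      linarith
    refine le_trans ?_ (mul_le_mul_of_nonneg_right h12 (by positivity))
    rw [div_mul_eq_mul_div, le_div_iff₀ hδ]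
    linarith
  · have : 1 / (ℓ * φ) ≤ 72 * B / α := by
      rw [div_le_div_iff₀ (by positivity) hα]
      rw [div_le_iff₀ (by positivity)] at hlow
      linarith
    -- The factor `144 = 2 * 72` in `c₁` leaves room for `(m + 1) / 2 ≤ m`.
    calc c₁ * (1 / (ℓ * φ)) ≤ c₁ * (72 * B / α) := by gcongr
      _ = c₁ * (144 * B) / (2 * α) := by field_simp; ring
      _ ≤ (m + 1) * α / (2 * α) := by rw [hc₁B]; gcongr
      _ = (m + 1) / 2 := by field_simp
      _ ≤ m := by linarith
  · have hBE : 2 * B * E ≤ c₂ := by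
      have : 0 < 12 / δ := by positivity
      linarith
    refine le_trans ?_ (mul_le_mul_of_nonneg_right hBE (by positivity))
    rw [mul_one_div, le_div_iff₀ (by positivity)]
    have hlφ : ℓ * φ ≤ E * α := by
      calc ℓ * φ ≤ ℓ * (E * (α / ℓ)) := by gcongr
        _ = E * α := by field_simp
    calc (2 * m + 1) * (ℓ * φ) ≤ (2 * (m + 1)) * (E * α) := by gcongr; linarith
      _ = 2 * E * ((m + 1) * α) := by ring
      _ ≤ 2 * E * B := by gcongr
      _ = _ := by ring

end Layering

/-- `a`, `b`, `C` are the constants in `α ∈ [Ω(1/n), O(1)]` and `ℓ ∈ [1, O(n²α²)]`. An algorithm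
solves broadcast in `T` rounds with probability at least `p` on a network drawn uniformly from the
class `𝒩` (e.g. on every network of `𝒩`) only if `T = Ω(min {Δ + D, 1 / φ_avg})`. -/
theorem mainTheorem9 (a b C : ℝ) (ha : 0 < a) (hb : 0 < b) (hC : 0 < C) :
    ∃ (c₁ c₂ : ℝ) (κ : ℝ → ℝ), 0 < c₁ ∧ 0 < c₂ ∧ (∀ p, 0 < p → 0 < κ p) ∧
      ∀ n : ℕ, 1 ≤ n → ∀ α : ℝ, a / n ≤ α → α ≤ b →
      ∀ ℓ : ℕ, 1 ≤ ℓ → (ℓ : ℝ) ≤ C * ((n : ℝ) ^ 2 * α ^ 2) →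
      ∃ 𝒩 : Finset (LatencyNetwork (Fin (2 * n))), 𝒩.Nonempty ∧
        (∀ N ∈ 𝒩,
          (c₁ * (α / ℓ) ≤ N.avgConductance ∧ N.avgConductance ≤ c₂ * (α / ℓ)) ∧
          (c₁ * (α * n) ≤ N.maxDeg ∧ (N.maxDeg : ℝ) ≤ c₂ * (α * n)) ∧
          (c₁ * (1 / (ℓ * N.avgConductance)) ≤ N.wdiam ∧
            (N.wdiam : ℝ) ≤ c₂ * (1 / (ℓ * N.avgConductance)))) ∧
        ∀ (A : GossipAlgorithm (Fin (2 * n))) (src : Fin (2 * n)) (p : ℝ), 0 < p →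
          ∀ T : ℕ, p ≤ (∑ N ∈ 𝒩, A.successProb N src T) / #𝒩 →
            ∀ N ∈ 𝒩,
              κ p * min ((N.maxDeg : ℝ) + N.wdiam) (1 / N.avgConductance) ≤ T := by
  have hδ : 0 < min 1 (2 * a) := lt_min one_pos (by linarith)
  obtain ⟨E, hE⟩ : ∃ E, E = (12 + 3 * C * (2 * b + 1) ^ 2) / min 1 (2 * a) := ⟨_, rfl⟩
  have hE0 : 0 < E := by rw [hE]; positivity
  refine ⟨min 1 (2 * a) / (144 * (2 * b + 1)), E + 12 / min 1 (2 * a) + 2 * (2 * b + 1) * E,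
    fun p => 1 / (24 / p + 576), by positivity, by positivity, fun p hp => by positivity,
    fun n hn α hα hαb ℓ hℓ hℓC => ?_⟩
  have hn' : (0 : ℝ) < n := by exact_mod_cast hn
  obtain ⟨m, hm, hmn, h1, h2⟩ := exists_number_of_layers ha hn hα hαb
  set L := Layering.residues (2 * n) m hm hmn
  refine ⟨L.networks hℓ, L.networks_nonempty hℓ, fun N hN => ?_,
    fun A src p hp T h N hN => L.mul_min_le_time hℓ A hp h hN⟩
  have h3 : 2 * n ≤ 2 * (2 * n / (m + 1)) * (m + 1) := by simpa using L.card_le'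
  have h4 : 2 * n / (m + 1) * (m + 1) ≤ 2 * n := Nat.div_mul_le_self _ _
  have h3' : n ≤ 2 * n / (m + 1) * (m + 1) := by rw [mul_assoc] at h3; omega
  exact L.parameters hℓ ((div_pos ha hn').trans_le hα) hC hδ (min_le_left _ _)
    (by linarith) hn' h1 h2 (by exact_mod_cast h3') (by exact_mod_cast h4) hℓC hN hE rfl rfl
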